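/- Let $\mathbb{H}$ be a separable complex Hilbert space. For a compact operator $x$ on $\mathbb{H}$ let $s_0(x)\ge s_1(x)\ge\dots$ be its singular values, i.e. the eigenvalues of $|x|=(x^*x)^{1/2}$ in decreasing order, repeated according to multiplicity and continued by $0$ if there are only finitely many nonzero ones. Let $\varphi:[0,\infty)\to[0,\infty]$ be an Orlicz function, that is, a convex, nondecreasing, continuous function with $\varphi(0)=0$, $\varphi(u)>0$ for $u>0$ and $\varphi(u)\to\infty$ as $u\to\infty$. Let $\psi(u)=\sup\{uv-\varphi(v):v\ge 0\}$ be its complementary function, and assume that $\psi(u)>0$ for all $u>0$. Let $S_\varphi$ be the set of compact operators $x$ on $\mathbb{H}$ with $\sum_{n\ge0}\varphi(\lambda s_n(x))<\infty$ for some $\lambda>0$, equipped with the Luxemburg norm $\|x\|_\varphi=\inf\{\lambda>0:\sum_{n\ge0}\varphi(s_n(x)/\lambda)\le1\}$. A function $f:[0,\infty)\to[0,\infty]$ satisfies $\delta_2(0)$ if there are $u_0>0$ and $k>2$ with $f(2u)\le k f(u)$ for all $0\le u\le u_0$. If both $\varphi$ and $\psi$ satisfy $\delta_2(0)$, then $(S_\varphi,\|\cdot\|_\varphi)$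 is a reflexive Banach space. In particular, for every real $p>1$, the Schatten class $S_p$ of all compact operators $x$ on $\mathbb{H}$ with $\sum_{n\ge0}s_n(x)^p<\infty$, equipped with the norm $\|x\|_p=\bigl(\sum_{n\ge0}s_n(x)^p\bigr)^{1/p}$, is a reflexive Banach space. -/

import Mathlib

open scoped NNReal ENNReal

noncomputable section

namespace OrliczSchatten

/-- Orlicz functions `φ : [0,∞) → [0,∞]`: convex, nondecreasing, continuous (for the topology of
the extended half-line), zero exactly at `0`, and tending to `∞` at infinity. -/
structure IsOrlicz (φ : ℝ≥0 → ℝ≥0∞) : Prop where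
  convex : ConvexOn ℝ≥0 Set.univ φ
  mono : Monotone φ
  cont : Continuous φ
  map_zero : φ 0 = 0
  pos : ∀ u, 0 < u → 0 < φ u
  tendsto_top : Filter.Tendsto φ Filter.atTop (nhds ∞)

/-- The complementary function `ψ(u) = sup {u v - φ(v) : v ≥ 0}`. Truncating the subtraction at
`0` is harmless: the supremum is nonnegative because of `v = 0` (if `φ 0 = 0`), and the terms
with `φ v = ∞` do not contribute. -/
def complementary (φ : ℝ≥0 → ℝ≥0∞) (u : ℝ≥0) : ℝ≥0∞ :=
  ⨆ v : ℝ≥0, (((u * v : ℝ≥0) : ℝ≥0∞) - φ v)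

/-- The condition `δ₂` near zero. -/
def DeltaTwoZero (φ : ℝ≥0 → ℝ≥0∞) : Prop :=
  ∃ u₀ : ℝ≥0, 0 < u₀ ∧ ∃ k : ℝ≥0, 2 < k ∧ ∀ u, u ≤ u₀ → φ (2 * u) ≤ (k : ℝ≥0∞) * φ u

section Operators

variable {H : Type*} [NormedAddCommGroup H] [InnerProductSpace ℂ H] [CompleteSpace H]

/-- The span of all eigenvectors of `|x| = (x* x)^{1/2}` whose eigenvalue exceeds `t`. Its
dimension is the number of eigenvalues of `|x|` above `t`, counted with multiplicity. -/
def eigenspaceAbove (x : H →L[ℂ] H) (t : ℝ≥0) : Submodule ℂ H :=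
  ⨆ μ : ℝ≥0, ⨆ _ : t < μ,
    Module.End.eigenspace ((CFC.abs x : H →L[ℂ] H) : H →ₗ[ℂ] H) ((μ : ℝ) : ℂ)

/-- The singular values of a compact operator `x`: the decreasing enumeration
`s₀ ≥ s₁ ≥ …` of the eigenvalues of `|x|`, repeated according to multiplicity (and continued by
`0` if `|x|` has only finitely many nonzero eigenvalues). That is, `sₙ` is the least `t ≥ 0` such
that `|x|` has at most `n` eigenvalues above `t`, counted with multiplicity. -/
def singularValue (x : H →L[ℂ] H) (n : ℕ) : ℝ≥0 :=
  sInf {t : ℝ≥0 | Module.rank ℂ (eigenspaceAbove x t) ≤ (n : Cardinal)}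

/-- `S_φ(H)`: the compact operators `x` with `Tr φ(λ|x|) = ∑ φ(λ sₙ(x)) < ∞` for some `λ > 0`. -/
def orliczClass (φ : ℝ≥0 → ℝ≥0∞) : Set (H →L[ℂ] H) :=
  {x | IsCompactOperator x ∧ ∃ c : ℝ≥0, 0 < c ∧ ∑' n, φ (c * singularValue x n) < ∞}

/-- The Luxemburg norm `inf {r > 0 : ∑ φ(sₙ(x) / r) ≤ 1}`. -/
def luxemburgNorm (φ : ℝ≥0 → ℝ≥0∞) (x : H →L[ℂ] H) : ℝ :=
  ((sInf {r : ℝ≥0 | 0 < r ∧ ∑' n, φ (singularValue x n / r) ≤ 1} : ℝ≥0) : ℝ)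

/-- The Schatten class `S_p(H)`: the compact operators `x` with `∑ sₙ(x)^p < ∞`. -/
def schattenClass (p : ℝ) : Set (H →L[ℂ] H) :=
  {x | IsCompactOperator x ∧ ∑' n, (singularValue x n : ℝ≥0∞) ^ p < ∞}

/-- The Schatten norm `(∑ sₙ(x)^p)^{1/p}`. -/
def schattenNorm (p : ℝ) (x : H →L[ℂ] H) : ℝ :=
  ((∑' n, (singularValue x n : ℝ≥0∞) ^ p) ^ (1 / p)).toReal

end Operators

/-- A normed space is reflexive if its canonical embedding into its topological bidual is onto
(in particular it is then complete). -/
def IsReflexiveSpace (E : Type*) [NormedAddCommGroup E] [NormedSpace ℂ E] : Prop :=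
  Function.Surjective (NormedSpace.inclusionInDoubleDual ℂ E)

/-- The subset `S` of the vector space `E`, equipped with the function `N`, is a reflexive Banach
space: `S` is a linear subspace of `E`, the restriction of `N` to `S` satisfies the axioms of a
norm, and the resulting normed space is reflexive. (No norm on `E` itself is involved.) -/
def IsReflexiveUnder {E : Type*} [AddCommGroup E] [Module ℂ E] (S : Set E) (N : E → ℝ) : Prop :=
  ∃ V : Submodule ℂ E, (V : Set E) = S ∧
    letI : Norm V := ⟨fun x => N x⟩
    ∃ core : NormedSpace.Core ℂ V,
      letI : NormedAddCommGroup V := NormedAddCommGroup.ofCore core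
      letI : NormedSpace ℂ V := NormedSpace.ofCore core
      IsReflexiveSpace V

end OrliczSchatten

end

/-! Everything rests on a variational formula: for compact `x`, the sum of φ over the singular
values equals the supremum of ∑ φ(|⟪uⱼ, x vⱼ⟫|) over pairs of finite families satisfying Bessel's
inequality (`IsOrlicz.tsum_singularValue`). One bound tests at the singular vectors. The other is
Jensen's inequality with a doubly substochastic matrix (`IsOrlicz.modular_le_sum`). The right side
involves only the sesquilinear form of `x`, so convexity, compression by contractions and passage to
pointwise limits become immediate, and the Luxemburg norm is seen to be a norm.

For reflexivity, take `z` in the unit ball of the bidual. Its values on the matrix coefficients y ↦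
⟪u, y v⟫ define a bounded operator `x`. By Helly's theorem these values are limits of values at
points of the unit ball, so `x` has φ-modular at most 1. The condition δ₂ for φ makes `x` compact
(`IsOrlicz.isCompactOperator`), hence `x` is a point of the space (`exists_point_of_bidual`).

It remains to see that matrix coefficients span a dense subspace of the dual
(`mem_closure_coeffSpan`). A functional of norm at most 1 has ψ-modular at most 1 on rank-one
operators. Compressing away from finite-dimensional subspaces makes that modular small, δ₂ for ψ
keeps it at most 1 after a large dilation, and Hölder's inequality, where δ₂ for φ provides density
of finite-rank operators, converts this into a small norm. The part removed is a finite sum of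
matrix coefficients. -/

namespace OrliczSchatten

/-! ### Scalar inequalities for Orlicz functions and their complementary functions. -/

section Scalar

variable {φ : ℝ≥0 → ℝ≥0∞}

theorem IsOrlicz.map_mul_le (hφ : IsOrlicz φ) {c : ℝ≥0} (hc : c ≤ 1) (t : ℝ≥0) :
    φ (c * t) ≤ c * φ t := by
  have h := hφ.convex.2 (Set.mem_univ t) (Set.mem_univ 0) zero_le zero_le
    (add_tsub_cancel_of_le hc)
  simpa [hφ.map_zero, ENNReal.smul_def] using h

theorem IsOrlicz.map_add_le (hφ : IsOrlicz φ) {a b : ℝ≥0} (hab : a + b ≤ 1) (s t : ℝ≥0) :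
    φ (a * s + b * t) ≤ a * φ s + b * φ t := by
  rcases eq_or_ne (a + b) 0 with h0 | h0
  · obtain ⟨rfl, rfl⟩ := add_eq_zero.1 h0
    simp [hφ.map_zero]
  have h1 : a / (a + b) + b / (a + b) = 1 := by rw [← add_div, div_self h0]
  have h := hφ.convex.2 (Set.mem_univ s) (Set.mem_univ t) zero_le
    zero_le h1
  have e : a * s + b * t = (a + b) * (a / (a + b) * s + b / (a + b) * t) := by
    field_simp
  rw [e]
  refine (hφ.map_mul_le hab _).trans ?_
  refine (mul_le_mul_right h _).trans_eq ?_
  simp only [ENNReal.smul_def, smul_eq_mul, mul_add, ← mul_assoc, ← ENNReal.coe_mul]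
  rw [mul_div_cancel₀ _ h0, mul_div_cancel₀ _ h0]

/-- Jensen's inequality for weights of total mass at most 1: the missing mass is put at 0, where φ
vanishes. -/
theorem IsOrlicz.map_sum_le (hφ : IsOrlicz φ) {ι : Type*} (s : Finset ι) (t : ι → ℝ≥0) :
    ∀ c : ι → ℝ≥0, ∑ i ∈ s, c i ≤ 1 → φ (∑ i ∈ s, c i * t i) ≤ ∑ i ∈ s, (c i : ℝ≥0∞) * φ (t i) := by
  classical
  induction s using Finset.induction_on with
  | empty => simp [hφ.map_zero]
  | insert j s hj ih =>
    intro c hc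
    rw [Finset.sum_insert hj] at hc ⊢
    rw [Finset.sum_insert hj]
    rcases eq_or_ne (∑ i ∈ s, c i) 0 with h0 | h0
    · have hz : ∀ i ∈ s, c i = 0 := fun i hi => (Finset.sum_eq_zero_iff.1 h0) i hi
      rw [Finset.sum_eq_zero (fun i hi => by simp [hz i hi]),
        Finset.sum_eq_zero (fun i hi => by simp [hz i hi]), add_zero, add_zero]
      exact hφ.map_mul_le (le_self_add.trans hc) _
    set r := ∑ i ∈ s, c i
    have h := ih (fun i => c i / r) (by rw [← Finset.sum_div, div_self h0])
    have e : ∑ i ∈ s, c i * t i = r * ∑ i ∈ s, c i / r * t i := by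
      rw [Finset.mul_sum]
      exact Finset.sum_congr rfl fun i _ => by field_simp
    rw [e]
    refine (hφ.map_add_le hc _ _).trans ?_
    gcongr
    refine (mul_le_mul_right h _).trans_eq ?_
    rw [Finset.mul_sum]
    refine Finset.sum_congr rfl fun i _ => ?_
    rw [← mul_assoc, ← ENNReal.coe_mul, mul_div_cancel₀ _ h0]

theorem IsOrlicz.comp_mul (hφ : IsOrlicz φ) {c : ℝ≥0} (hc : 0 < c) :
    IsOrlicz fun u => φ (c * u) where
  convex := by
    refine ⟨convex_univ, fun x _ y _ a b ha hb hab => ?_⟩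
    have := hφ.convex.2 (Set.mem_univ (c * x)) (Set.mem_univ (c * y)) ha hb hab
    convert this using 2
    simp only [smul_eq_mul]
    ring
  mono := fun x y h => hφ.mono (mul_le_mul_right h c)
  cont := hφ.cont.comp (continuous_const.mul continuous_id)
  map_zero := by simp [hφ.map_zero]
  pos := fun u hu => hφ.pos _ (mul_pos hc hu)
  tendsto_top := hφ.tendsto_top.comp (Filter.tendsto_id.const_mul_atTop hc)

theorem IsOrlicz.exists_one_lt (hφ : IsOrlicz φ) : ∃ C : ℝ≥0, 1 < φ C := by
  exact (hφ.tendsto_top.eventually (lt_mem_nhds ENNReal.one_lt_top)).exists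

/-- Iterating `δ₂`: a small value of `φ` bounds the value at a dilated argument. -/
theorem DeltaTwoZero.iterate (h : DeltaTwoZero φ) (hmono : Monotone φ)
    (hpos : ∀ u, 0 < u → 0 < φ u) (m : ℕ) :
    ∃ ε : ℝ≥0∞, 0 < ε ∧ ∃ K : ℝ≥0, 0 < K ∧ ∀ u, φ u ≤ ε → φ (2 ^ m * u) ≤ K * φ u := by
  obtain ⟨u₀, hu₀, k, hk, H⟩ := h
  have hk0 : 0 < k := by linarith
  have key : ∀ m : ℕ, ∀ u, 2 ^ m * u ≤ u₀ → φ (2 ^ m * u) ≤ (k ^ m : ℝ≥0) * φ u := by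
    intro m
    induction m with
    | zero => simp
    | succ m ih =>
      intro u hu
      have h1 : 2 ^ m * u ≤ u₀ := by
        refine le_trans ?_ hu
        gcongr
        · norm_num
        · omega
      rw [pow_succ' 2, mul_assoc, pow_succ' k, ENNReal.coe_mul, mul_assoc]
      exact (H _ h1).trans (mul_le_mul_right (ih u h1) _)
  set u₁ := u₀ / 2 ^ m
  have hu₁ : 0 < u₁ := by positivity
  have hmin : min (φ u₁) 1 ≠ 0 := (lt_min (hpos _ hu₁) one_pos).ne'
  have hmin' : min (φ u₁) 1 ≠ ∞ := (min_le_right _ _).trans_lt ENNReal.one_lt_top |>.ne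
  -- The cap by 1 keeps the threshold finite, so that its half is strictly below φ(u₁) and
  -- monotonicity forces u < u₁.
  refine ⟨min (φ u₁) 1 / 2, ENNReal.half_pos hmin, k ^ m, by positivity, fun u hu => ?_⟩
  apply key
  have hlt : φ u < φ u₁ := hu.trans_lt ((ENNReal.half_lt_self hmin hmin').trans_le (min_le_left _ _))
  have : u < u₁ := hmono.reflect_lt hlt
  calc 2 ^ m * u ≤ 2 ^ m * u₁ := by gcongr
    _ = u₀ := by simp only [u₁]; field_simp

theorem complementary_mono (φ : ℝ≥0 → ℝ≥0∞) : Monotone (complementary φ) := fun a b h => by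
  unfold complementary
  gcongr

theorem mul_le_add_complementary (φ : ℝ≥0 → ℝ≥0∞) (s t : ℝ≥0) :
    ((s * t : ℝ≥0) : ℝ≥0∞) ≤ φ s + complementary φ t := by
  have : ((t * s : ℝ≥0) : ℝ≥0∞) - φ s ≤ complementary φ t :=
    le_iSup (fun v : ℝ≥0 => ((t * v : ℝ≥0) : ℝ≥0∞) - φ v) s
  rw [mul_comm]
  exact tsub_le_iff_left.1 this

/-- If the pairing with `α` is bounded by `max 1 (∑ φ tⱼ)`, then `∑ ψ αⱼ ≤ 1`. -/
theorem sum_complementary_le_one (h0 : φ 0 = 0) {ι : Type*} [Fintype ι] (α : ι → ℝ≥0)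
    (h : ∀ t : ι → ℝ≥0, ((∑ j, α j * t j : ℝ≥0) : ℝ≥0∞) ≤ max 1 (∑ j, φ (t j))) :
    ∑ j, complementary φ (α j) ≤ 1 := by
  have hseq : ∀ j, ∃ t : ℕ → ℝ≥0, Filter.Tendsto (fun n => ((α j * t n : ℝ≥0) : ℝ≥0∞) - φ (t n))
      Filter.atTop (nhds (complementary φ (α j))) := by
    intro j
    obtain ⟨u, -, hu, hu'⟩ := exists_seq_tendsto_sSup
      (Set.range_nonempty fun v : ℝ≥0 => ((α j * v : ℝ≥0) : ℝ≥0∞) - φ v) (OrderTop.bddAbove _)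
    choose t ht using hu'
    refine ⟨t, ?_⟩
    simp only [ht]
    exact hu
  choose t ht using hseq
  refine le_of_tendsto' (tendsto_finsetSum _ fun j _ => ht j) fun n => ?_
  -- Points where the truncated difference vanishes are replaced by 0. Then all φ(sⱼ) are finite and
  -- the subtraction can be undone.
  set s : ι → ℝ≥0 := fun j => if ((α j * t j n : ℝ≥0) : ℝ≥0∞) ≤ φ (t j n) then 0 else t j n
  have hs : ∀ j, φ (s j) ≤ ((α j * s j : ℝ≥0) : ℝ≥0∞) := by
    intro j
    by_cases hj : ((α j * t j n : ℝ≥0) : ℝ≥0∞) ≤ φ (t j n)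
    · simp only [show s j = 0 from if_pos hj, h0, mul_zero, ENNReal.coe_zero, le_refl]
    · rw [show s j = t j n from if_neg hj]
      exact (not_le.1 hj).le
  have hst : ∀ j, ((α j * t j n : ℝ≥0) : ℝ≥0∞) - φ (t j n) = ((α j * s j : ℝ≥0) : ℝ≥0∞) - φ (s j) := by
    intro j
    by_cases hj : ((α j * t j n : ℝ≥0) : ℝ≥0∞) ≤ φ (t j n)
    · simp only [show s j = 0 from if_pos hj, tsub_eq_zero_of_le hj, mul_zero, ENNReal.coe_zero,
        zero_tsub]
    · rw [show s j = t j n from if_neg hj]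
  have hfin : ∑ j, φ (s j) ≠ ∞ :=
    ENNReal.sum_ne_top.2 fun j _ => ((hs j).trans_lt ENNReal.coe_lt_top).ne
  have e : (∑ j, (((α j * s j : ℝ≥0) : ℝ≥0∞) - φ (s j))) + ∑ j, φ (s j)
      = ((∑ j, α j * s j : ℝ≥0) : ℝ≥0∞) := by
    rw [← Finset.sum_add_distrib]
    push_cast
    exact Finset.sum_congr rfl fun j _ => by simpa using tsub_add_cancel_of_le (hs j)
  simp only [hst]
  -- With S = ∑ φ(sⱼ) finite, the claim reduces to max(1, S) ≤ 1 + S.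
  refine (ENNReal.add_le_add_iff_right hfin).1 (e.trans_le ((h s).trans ?_))
  exact max_le (le_self_add) (le_add_self)

end Scalar

/-! ### Finite Bessel families. -/

section Bessel

variable {H : Type*} [NormedAddCommGroup H] [InnerProductSpace ℂ H]
variable {ι κ : Type*} [Fintype ι] [Fintype κ]

/-- Finite families satisfying Bessel's inequality. -/
def IsBessel (u : ι → H) : Prop :=
  ∀ h, ∑ j, ‖inner ℂ (u j) h‖ ^ 2 ≤ ‖h‖ ^ 2

theorem IsBessel.norm_le_one {u : ι → H} (hu : IsBessel u) (j : ι) : ‖u j‖ ≤ 1 := by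
  have h1 : ‖inner ℂ (u j) (u j)‖ ^ 2 ≤ ‖u j‖ ^ 2 :=
    (Finset.single_le_sum (f := fun i => ‖inner ℂ (u i) (u j)‖ ^ 2)
      (fun i _ => by positivity) (Finset.mem_univ j)).trans (hu (u j))
  rw [inner_self_eq_norm_sq_to_K] at h1
  simp only [norm_pow, Complex.coe_algebraMap, Complex.norm_real, norm_norm] at h1
  by_contra! hlt
  nlinarith [mul_pos (sub_pos.2 hlt) (zero_lt_one.trans hlt), sq_nonneg (‖u j‖)]

theorem IsBessel.sum_nnnorm_sq_le_one {u : ι → H} (hu : IsBessel u) {h : H} (hh : ‖h‖ ≤ 1) :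
    ∑ j, ‖inner ℂ (u j) h‖₊ ^ 2 ≤ 1 := by
  rw [← NNReal.coe_le_coe]
  push_cast
  exact (hu h).trans (pow_le_one₀ (norm_nonneg _) hh)

theorem nnnorm_inner_symm (x y : H) : ‖inner ℂ x y‖₊ = ‖inner ℂ y x‖₊ :=
  NNReal.eq (norm_inner_symm x y)

theorem IsBessel.comp_injective {u : ι → H} (hu : IsBessel u) {g : κ → ι}
    (hg : Function.Injective g) : IsBessel fun k => u (g k) := fun h => by
  classical
  refine le_trans ?_ (hu h)
  rw [← Finset.sum_image (s := Finset.univ) (g := g)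
    (f := fun i => ‖inner ℂ (u i) h‖ ^ 2) fun a _ b _ hab => hg hab]
  exact Finset.sum_le_univ_sum_of_nonneg fun i => by positivity

theorem isBessel_unit {u : H} (hu : ‖u‖ ≤ 1) : IsBessel fun _ : Unit => u := fun h => by
  simp only [Finset.univ_unique, Finset.sum_const, Finset.card_singleton, one_smul]
  have := norm_inner_le_norm (𝕜 := ℂ) u h
  gcongr
  exact this.trans (mul_le_of_le_one_left (norm_nonneg _) hu)

theorem Orthonormal.isBessel {ι : Type*} {e : ι → H} (he : Orthonormal ℂ e) (s : Finset ι) :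
    IsBessel fun i : s => e i := fun h => by
  rw [Finset.sum_coe_sort s fun i => ‖inner ℂ (e i) h‖ ^ 2]
  exact he.sum_inner_products_le h

theorem IsBessel.adjoint [CompleteSpace H] {u : ι → H} (hu : IsBessel u) {a : H →L[ℂ] H}
    (ha : ‖a‖ ≤ 1) : IsBessel fun j => (ContinuousLinearMap.adjoint a) (u j) := fun h => by
  simp only [ContinuousLinearMap.adjoint_inner_left]
  refine (hu (a h)).trans ?_
  gcongr
  simpa using a.le_of_opNorm_le ha h

/-- By Pythagoras, a family inside U and a family projected onto Uᗮ share the norm of a test vector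
without overlap. This makes modulars superadditive over orthogonal pieces. -/
theorem IsBessel.sum {u : ι → H} {w : κ → H} (hu : IsBessel u) (hw : IsBessel w)
    (U : Submodule ℂ H) [U.HasOrthogonalProjection] (hU : ∀ j, u j ∈ U) :
    IsBessel (Sum.elim u fun k => Uᗮ.starProjection (w k)) := fun h => by
  rw [Fintype.sum_sum_type]
  simp only [Sum.elim_inl, Sum.elim_inr, Submodule.inner_starProjection_left_eq_right]
  rw [Submodule.norm_sq_eq_add_norm_sq_starProjection h U]
  refine add_le_add ?_ (hw _)
  refine le_trans (le_of_eq ?_) (hu (U.starProjection h))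
  refine Finset.sum_congr rfl fun j _ => ?_
  rw [← Submodule.inner_starProjection_left_eq_right, Submodule.starProjection_eq_self_iff.2 (hU j)]

end Bessel

/-! ### The variational modular of a form. -/

section Modular

variable {H : Type*} [NormedAddCommGroup H] [InnerProductSpace ℂ H]
variable {φ : ℝ≥0 → ℝ≥0∞}

/-- The modular `sup ∑ φ (F uⱼ vⱼ)` over finite Bessel families. -/
noncomputable def modular (φ : ℝ≥0 → ℝ≥0∞) (F : H → H → ℝ≥0) : ℝ≥0∞ :=
  ⨆ (n : ℕ) (u : Fin n → H) (v : Fin n → H) (_ : IsBessel u) (_ : IsBessel v),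
    ∑ j, φ (F (u j) (v j))

theorem modular_le {F : H → H → ℝ≥0} {C : ℝ≥0∞}
    (h : ∀ (n : ℕ) (u v : Fin n → H), IsBessel u → IsBessel v → ∑ j, φ (F (u j) (v j)) ≤ C) :
    modular φ F ≤ C :=
  iSup_le fun n => iSup_le fun u => iSup_le fun v => iSup_le fun hu => iSup_le fun hv =>
    h n u v hu hv

theorem le_modular {ι : Type*} [Fintype ι] (φ : ℝ≥0 → ℝ≥0∞) (F : H → H → ℝ≥0) {u v : ι → H}
    (hu : IsBessel u) (hv : IsBessel v) : ∑ j, φ (F (u j) (v j)) ≤ modular φ F := by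
  have e := (Fintype.equivFin ι).symm
  have h : ∑ j, φ (F (u (e j)) (v (e j))) ≤ modular φ F :=
    le_iSup_of_le (Fintype.card ι) <| le_iSup_of_le (fun j => u (e j)) <|
      le_iSup_of_le (fun j => v (e j)) <| le_iSup_of_le (hu.comp_injective e.injective) <|
      le_iSup_of_le (hv.comp_injective e.injective) le_rfl
  rwa [Equiv.sum_comp e fun j => φ (F (u j) (v j))] at h

theorem apply_le_modular (φ : ℝ≥0 → ℝ≥0∞) (F : H → H → ℝ≥0) {u v : H} (hu : ‖u‖ ≤ 1)
    (hv : ‖v‖ ≤ 1) : φ (F u v) ≤ modular φ F := by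
  simpa using le_modular φ F (isBessel_unit hu) (isBessel_unit hv)

theorem exists_lt_sum_of_lt_modular {F : H → H → ℝ≥0} {C : ℝ≥0∞} (h : C < modular φ F) :
    ∃ (n : ℕ) (u v : Fin n → H), IsBessel u ∧ IsBessel v ∧ C < ∑ j, φ (F (u j) (v j)) := by
  by_contra! hc
  exact not_le.2 h (modular_le hc)

theorem modular_mono (hφ : Monotone φ) {F G : H → H → ℝ≥0} (h : ∀ u v, F u v ≤ G u v) :
    modular φ F ≤ modular φ G :=
  modular_le fun _ _ _ hu hv =>
    (Finset.sum_le_sum fun _ _ => hφ (h _ _)).trans (le_modular φ G hu hv)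

theorem IsOrlicz.modular_add_le (hφ : IsOrlicz φ) {F G K : H → H → ℝ≥0} {a b : ℝ≥0}
    (hab : a + b ≤ 1) (h : ∀ u v, K u v ≤ a * F u v + b * G u v) :
    modular φ K ≤ a * modular φ F + b * modular φ G := by
  refine modular_le fun n u v hu hv => ?_
  calc ∑ j, φ (K (u j) (v j)) ≤ ∑ j, (a * φ (F (u j) (v j)) + b * φ (G (u j) (v j))) :=
        Finset.sum_le_sum fun j _ => (hφ.mono (h _ _)).trans (hφ.map_add_le hab _ _)
    _ = a * ∑ j, φ (F (u j) (v j)) + b * ∑ j, φ (G (u j) (v j)) := by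
        rw [Finset.sum_add_distrib, Finset.mul_sum, Finset.mul_sum]
    _ ≤ _ := by gcongr <;> exact le_modular _ _ hu hv

theorem IsOrlicz.modular_mul_le (hφ : IsOrlicz φ) (F : H → H → ℝ≥0) {a : ℝ≥0} (ha : a ≤ 1) :
    modular φ (fun u v => a * F u v) ≤ a * modular φ F := by
  simpa using hφ.modular_add_le (F := F) (G := fun _ _ => 0) (b := 0) (by simpa using ha)
    (fun u v => by simp)

/-- The growth bound is available only where φ is small, but each single term is dominated by the
whole modular and so lies in that range. -/
theorem modular_scale_le {F : H → H → ℝ≥0} {ε K : ℝ≥0∞} {c : ℝ≥0}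
    (h : ∀ u, φ u ≤ ε → φ (c * u) ≤ K * φ u) (hF : modular φ F ≤ ε) :
    modular φ (fun u v => c * F u v) ≤ K * modular φ F := by
  refine modular_le fun n u v hu hv => ?_
  calc ∑ j, φ (c * F (u j) (v j)) ≤ ∑ j, K * φ (F (u j) (v j)) :=
        Finset.sum_le_sum fun j _ => h _
          ((apply_le_modular φ F (hu.norm_le_one j) (hv.norm_le_one j)).trans hF)
    _ = K * ∑ j, φ (F (u j) (v j)) := by rw [Finset.mul_sum]
    _ ≤ _ := by gcongr; exact le_modular _ _ hu hv

/-- Under `δ₂`, a small modular stays below `1` after dilation. -/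
theorem DeltaTwoZero.exists_modular_scale_le_one (h : DeltaTwoZero φ) (hmono : Monotone φ)
    (hpos : ∀ u, 0 < u → 0 < φ u) (m : ℕ) :
    ∃ ε : ℝ≥0∞, 0 < ε ∧ ∀ F : H → H → ℝ≥0, modular φ F ≤ ε →
      modular φ (fun u v => 2 ^ m * F u v) ≤ 1 := by
  obtain ⟨ε, hε, K, hK, H⟩ := h.iterate hmono hpos m
  refine ⟨min ε (K : ℝ≥0∞)⁻¹, lt_min hε (by simp), fun F hF => ?_⟩
  refine (modular_scale_le (K := K) H (hF.trans (min_le_left _ _))).trans ?_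
  calc (K : ℝ≥0∞) * modular φ F ≤ K * (K : ℝ≥0∞)⁻¹ := by gcongr; exact hF.trans (min_le_right _ _)
    _ ≤ 1 := ENNReal.mul_inv_le_one _

/-- Lower semicontinuity: a supremum of finite sums, each continuous under pointwise convergence of
the form. -/
theorem modular_le_of_tendsto (hφ : Continuous φ) {α : Type*} {l : Filter α} [l.NeBot]
    {F : α → H → H → ℝ≥0} {G : H → H → ℝ≥0} {C : ℝ≥0∞}
    (h : ∀ u v, Filter.Tendsto (fun a => F a u v) l (nhds (G u v)))
    (hC : ∀ a, modular φ (F a) ≤ C) : modular φ G ≤ C :=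
  modular_le fun _ _ _ hu hv =>
    le_of_tendsto' (tendsto_finsetSum _ fun _ _ => (hφ.tendsto _).comp (h _ _))
      fun a => (le_modular φ (F a) hu hv).trans (hC a)

/-- Cutting off finite-dimensional subspaces makes a finite modular arbitrarily small. -/
theorem exists_modular_cutoff_le {F : H → H → ℝ≥0} (hF : modular φ F ≠ ∞) {ε : ℝ≥0∞}
    (hε : 0 < ε) :
    ∃ (U V : Submodule ℂ H) (_ : FiniteDimensional ℂ U) (_ : FiniteDimensional ℂ V),
      modular φ (fun u v => F (Uᗮ.starProjection u) (Vᗮ.starProjection v)) ≤ ε := by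
  obtain ⟨n, u, v, hu, hv, h⟩ : ∃ (n : ℕ) (u v : Fin n → H), IsBessel u ∧ IsBessel v ∧
      modular φ F ≤ (∑ j, φ (F (u j) (v j))) + ε := by
    rcases eq_or_ne (modular φ F) 0 with h0 | h0
    · exact ⟨0, fun i => i.elim0, fun i => i.elim0, fun h => by simp, fun h => by simp,
        by simp [h0]⟩
    · obtain ⟨n, u, v, hu, hv, h⟩ :=
        exists_lt_sum_of_lt_modular (ENNReal.sub_lt_self hF h0 hε.ne')
      exact ⟨n, u, v, hu, hv, tsub_le_iff_right.1 h.le⟩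
  have hU : FiniteDimensional ℂ (Submodule.span ℂ (Set.range u)) :=
    FiniteDimensional.span_of_finite ℂ (Set.finite_range u)
  have hV : FiniteDimensional ℂ (Submodule.span ℂ (Set.range v)) :=
    FiniteDimensional.span_of_finite ℂ (Set.finite_range v)
  refine ⟨Submodule.span ℂ (Set.range u), Submodule.span ℂ (Set.range v), hU, hV, modular_le fun m w z hw hz => ?_⟩
  have hS : ∑ j, φ (F (u j) (v j)) ≠ ∞ := ((le_modular φ F hu hv).trans_lt hF.lt_top).ne
  -- A nearly optimal pair of families extended by projected ones is again admissible, so the extra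
  -- terms cannot exceed the defect ε.
  have h2 := le_modular φ F
    (hu.sum hw (Submodule.span ℂ (Set.range u)) fun j => Submodule.subset_span ⟨j, rfl⟩)
    (hv.sum hz (Submodule.span ℂ (Set.range v)) fun j => Submodule.subset_span ⟨j, rfl⟩)
  rw [Fintype.sum_sum_type] at h2
  exact (ENNReal.add_le_add_iff_left hS).1 (h2.trans h)

/-- A combination of rank-one forms along Bessel families has modular at most the sum. -/
theorem IsOrlicz.modular_le_sum (hφ : IsOrlicz φ) {ι : Type*} [Fintype ι] {u v : ι → H}
    (hu : IsBessel u) (hv : IsBessel v) (t : ι → ℝ≥0) {F : H → H → ℝ≥0}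
    (hF : ∀ a b, F a b ≤ ∑ j, t j * (‖inner ℂ a (v j)‖₊ * ‖inner ℂ (u j) b‖₊)) :
    modular φ F ≤ ∑ j, φ (t j) := by
  refine modular_le fun n a b ha hb => ?_
  -- By the arithmetic-geometric mean inequality these weights dominate the products of inner
  -- products, and Bessel's inequality bounds all row and column sums by 1.
  set c : Fin n → ι → ℝ≥0 := fun k j => (‖inner ℂ (v j) (a k)‖₊ ^ 2 + ‖inner ℂ (u j) (b k)‖₊ ^ 2) / 2
  have hrow : ∀ k, ∑ j, c k j ≤ 1 := fun k => by
    simp only [c]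
    rw [← Finset.sum_div, Finset.sum_add_distrib]
    refine div_le_of_le_mul₀ zero_le zero_le ?_
    exact (add_le_add (hv.sum_nnnorm_sq_le_one (ha.norm_le_one k))
      (hu.sum_nnnorm_sq_le_one (hb.norm_le_one k))).trans_eq (by norm_num)
  have hcol : ∀ j, ∑ k, c k j ≤ 1 := fun j => by
    simp only [c]
    rw [← Finset.sum_div, Finset.sum_add_distrib]
    refine div_le_of_le_mul₀ zero_le zero_le ?_
    simp only [nnnorm_inner_symm (v j), nnnorm_inner_symm (u j)]
    exact (add_le_add (ha.sum_nnnorm_sq_le_one (hv.norm_le_one j))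
      (hb.sum_nnnorm_sq_le_one (hu.norm_le_one j))).trans_eq (by norm_num)
  have hle : ∀ k, F (a k) (b k) ≤ ∑ j, c k j * t j := fun k => by
    refine (hF _ _).trans (Finset.sum_le_sum fun j _ => ?_)
    rw [mul_comm]
    gcongr
    simp only [c]
    rw [nnnorm_inner_symm, ← NNReal.coe_le_coe]
    push_cast
    nlinarith [sq_nonneg (‖inner ℂ (v j) (a k)‖ - ‖inner ℂ (u j) (b k)‖)]
  calc ∑ k, φ (F (a k) (b k)) ≤ ∑ k, ∑ j, (c k j : ℝ≥0∞) * φ (t j) :=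
        Finset.sum_le_sum fun k _ =>
          (hφ.mono (hle k)).trans (hφ.map_sum_le _ _ _ (hrow k))
    _ = ∑ j, ((∑ k, c k j : ℝ≥0) : ℝ≥0∞) * φ (t j) := by
        rw [Finset.sum_comm]
        refine Finset.sum_congr rfl fun j _ => ?_
        rw [← Finset.sum_mul]
        push_cast
        rfl
    _ ≤ ∑ j, φ (t j) := Finset.sum_le_sum fun j _ =>
        mul_le_of_le_one_left zero_le (by exact_mod_cast hcol j)

end Modular

/-! ### Equimeasurable families and decreasing enumeration. -/

section Rearrangement

/-- Families with the same finite superlevel counts have the same fibres over positive values. -/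
theorem nonempty_fiber_equiv {ι κ : Type*} {a : ι → ℝ≥0} {b : κ → ℝ≥0}
    (ha : ∀ t, 0 < t → {i | t < a i}.Finite) (hb : ∀ t, 0 < t → {k | t < b k}.Finite)
    (hab : ∀ t, 0 < t → {i | t < a i}.ncard = {k | t < b k}.ncard) {c : ℝ≥0} (hc : 0 < c) :
    Nonempty ({i // a i = c} ≃ {k // b k = c}) := by
  have hc2 : 0 < c / 2 := by positivity
  have hlt : c / 2 < c := NNReal.half_lt_self hc.ne'
  set F : Set ℝ≥0 := a '' {i | c / 2 < a i} ∪ b '' {k | c / 2 < b k}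
  have hF : F.Finite := ((ha _ hc2).image a).union ((hb _ hc2).image b)
  -- Only finitely many values exceed c/2, so some level just below c isolates c: the fibre over c
  -- is the difference of the superlevel sets at t and at c.
  obtain ⟨t, ht, htc⟩ : ∃ t, (∀ y ∈ F, y < c → y ≤ t) ∧ t ∈ Set.Ioo (c / 2) c := by
    have h1 : ∀ᶠ t in nhdsWithin c (Set.Iio c), ∀ y ∈ F, y < c → y ≤ t := by
      refine (Filter.eventually_all_finite hF).2 fun y _ => ?_
      by_cases hy : y < c
      · filter_upwards [Ioo_mem_nhdsLT hy] with t ht _ using ht.1.le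
      · exact Filter.Eventually.of_forall fun t h => absurd h hy
    have hne : (nhdsWithin c (Set.Iio c)).NeBot := nhdsLT_neBot_of_exists_lt ⟨_, hlt⟩
    exact (h1.and (Ioo_mem_nhdsLT hlt)).exists
  have ht0 : 0 < t := hc2.trans htc.1
  have ea : {i | a i = c} = {i | t < a i} \ {i | c < a i} := by
    ext i
    constructor
    · rintro rfl
      exact ⟨htc.2, fun h => absurd (show (_ : ℝ≥0) < _ from h) (lt_irrefl _)⟩
    · rintro ⟨h1, h2⟩
      by_contra hne
      have h3 : a i < c := lt_of_le_of_ne (not_lt.1 h2) hne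
      exact not_le.2 h1 (ht _ (Or.inl ⟨i, htc.1.trans h1, rfl⟩) h3)
  have eb : {k | b k = c} = {k | t < b k} \ {k | c < b k} := by
    ext i
    constructor
    · rintro rfl
      exact ⟨htc.2, fun h => absurd (show (_ : ℝ≥0) < _ from h) (lt_irrefl _)⟩
    · rintro ⟨h1, h2⟩
      by_contra hne
      have h3 : b i < c := lt_of_le_of_ne (not_lt.1 h2) hne
      exact not_le.2 h1 (ht _ (Or.inr ⟨i, htc.1.trans h1, rfl⟩) h3)
  have sa : {i | c < a i} ⊆ {i | t < a i} := fun i hi => htc.2.trans hi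
  have sb : {k | c < b k} ⊆ {k | t < b k} := fun i hi => htc.2.trans hi
  have hcard : {i | a i = c}.ncard = {k | b k = c}.ncard := by
    rw [ea, eb, Set.ncard_sdiff sa (ha c hc),
      Set.ncard_sdiff sb (hb c hc), hab t ht0, hab c hc]
  have : Finite {i // a i = c} := by
    have : {i | a i = c}.Finite := by rw [ea]; exact (ha t ht0).sdiff
    exact this
  have : Finite {k // b k = c} := by
    have : {k | b k = c}.Finite := by rw [eb]; exact (hb t ht0).sdiff
    exact this
  exact Finite.card_eq.1 hcard

/-- Summation is done fibre by fibre. The fibres over 0 may have different cardinalities but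
contribute nothing. -/
theorem tsum_comp_eq_of_ncard_eq {ι κ : Type*} {a : ι → ℝ≥0} {b : κ → ℝ≥0}
    (ha : ∀ t, 0 < t → {i | t < a i}.Finite) (hb : ∀ t, 0 < t → {k | t < b k}.Finite)
    (hab : ∀ t, 0 < t → {i | t < a i}.ncard = {k | t < b k}.ncard)
    {φ : ℝ≥0 → ℝ≥0∞} (h0 : φ 0 = 0) : ∑' i, φ (a i) = ∑' k, φ (b k) := by
  rw [← (Equiv.sigmaFiberEquiv a).tsum_eq fun i => φ (a i),
    ← (Equiv.sigmaFiberEquiv b).tsum_eq fun k => φ (b k), ENNReal.tsum_sigma', ENNReal.tsum_sigma']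
  refine tsum_congr fun c => ?_
  have e1 : ∀ i : {i // a i = c}, φ (a (Equiv.sigmaFiberEquiv a ⟨c, i⟩)) = φ c := fun i => by
    rw [Equiv.sigmaFiberEquiv_apply, i.2]
  have e2 : ∀ k : {k // b k = c}, φ (b (Equiv.sigmaFiberEquiv b ⟨c, k⟩)) = φ c := fun k => by
    rw [Equiv.sigmaFiberEquiv_apply, k.2]
  rw [tsum_congr e1, tsum_congr e2]
  rcases eq_or_ne c 0 with rfl | hc
  · simp [h0]
  · obtain ⟨e⟩ := nonempty_fiber_equiv ha hb hab (pos_iff_ne_zero.2 hc)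
    exact e.tsum_eq fun _ => φ c

/-- The decreasing enumeration of a family with finite superlevel sets. -/
theorem tsum_decreasing_enumeration {ι : Type*} {a : ι → ℝ≥0}
    (ha : ∀ t, 0 < t → {i | t < a i}.Finite) {φ : ℝ≥0 → ℝ≥0∞} (h0 : φ 0 = 0) :
    ∑' n : ℕ, φ (sInf {t : ℝ≥0 | Cardinal.mk {i | t < a i} ≤ (n : Cardinal)}) = ∑' i, φ (a i) := by
  set s : ℕ → ℝ≥0 := fun n => sInf {t : ℝ≥0 | Cardinal.mk {i | t < a i} ≤ (n : Cardinal)}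
  have hmk : ∀ t, 0 < t → ∀ n : ℕ,
      (Cardinal.mk {i | t < a i} ≤ (n : Cardinal) ↔ {i | t < a i}.ncard ≤ n) := fun t ht n => by
    have := (ha t ht).to_subtype
    rw [← Nat.cast_card, Nat.cast_le]
    rfl
  have hne : ∀ n : ℕ, {t : ℝ≥0 | Cardinal.mk {i | t < a i} ≤ (n : Cardinal)}.Nonempty := fun n => by
    obtain ⟨M, hM⟩ := ((ha 1 one_pos).image a).bddAbove
    refine ⟨max M 1, ?_⟩
    have : {i | max M 1 < a i} = ∅ := by
      ext i
      simp only [Set.mem_ofPred_eq, Set.mem_empty_iff_false, iff_false, not_lt]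
      by_contra! hi
      exact not_le.2 ((le_max_left _ _).trans_lt hi) (hM ⟨i, (le_max_right _ _).trans_lt hi, rfl⟩)
    simp only [Set.mem_ofPred_eq, this]
    simp
  have key : ∀ t, 0 < t → ∀ n, t < s n ↔ n < {i | t < a i}.ncard := by
    intro t ht n
    constructor
    · intro h
      by_contra! hn
      exact not_le.2 h (csInf_le (OrderBot.bddBelow _) ((hmk t ht n).2 hn))
    · intro hn
      have hfin := ha t ht
      have hnon : {i | t < a i}.Nonempty := by
        rw [← Set.ncard_pos hfin]
        omega
      obtain ⟨i₀, hi₀, hmin⟩ := Set.exists_min_image _ a hfin hnon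
      refine lt_of_lt_of_le hi₀ (le_csInf (hne n) fun t' ht' => ?_)
      by_contra! hlt
      -- At level 0 the superlevel set is not known to be finite beforehand, so the comparison there
      -- goes through cardinals instead of `ncard`.
      rcases eq_or_ne t' 0 with rfl | h'
      · have hsub : {i | t < a i} ⊆ {i | 0 < a i} := fun i hi => ht.trans hi
        have h0 : Cardinal.mk {i | 0 < a i} ≤ (n : Cardinal) := ht'
        have h1 := (Cardinal.mk_le_mk_of_subset hsub).trans h0
        rw [hmk t ht n] at h1
        omega
      · have ht'0 := pos_iff_ne_zero.2 h'
        have h1 := (hmk t' ht'0 n).1 ht'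
        have h2 : {i | t < a i}.ncard ≤ {i | t' < a i}.ncard :=
          Set.ncard_le_ncard (fun i hi => hlt.trans_le (hmin i hi)) (ha t' ht'0)
        omega
  have hset : ∀ t, 0 < t → {n | t < s n} = Set.Iio {i | t < a i}.ncard := fun t ht => by
    ext n
    exact key t ht n
  refine tsum_comp_eq_of_ncard_eq (fun t ht => ?_) ha (fun t ht => ?_) h0
  · rw [hset t ht]
    exact Set.finite_Iio _
  · rw [hset t ht, ← Nat.card_coe_set_eq]
    simp

end Rearrangement

/-! ### Singular value decomposition of compact operators. -/

section Singular

open scoped ComplexOrder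

variable {H : Type*} [NormedAddCommGroup H] [InnerProductSpace ℂ H]

/-- The images of distinct eigenvectors are orthogonal; if both eigenvalues exceed t, they are more
than t apart, which total boundedness permits only finitely often. -/
theorem finite_setOf_lt_of_orthonormal {A : H →L[ℂ] H} (hA : IsCompactOperator A) {ι : Type*}
    {e : ι → H} (he : Orthonormal ℂ e) {μ : ι → ℝ≥0} (hμ : ∀ i, A (e i) = (μ i : ℂ) • e i)
    {t : ℝ≥0} (ht : 0 < t) : {i | t < μ i}.Finite := by
  have h1 := (hA.isCompact_closure_image_closedBall (𝕜₁ := ℂ)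
    (f := (A : H →ₗ[ℂ] H)) 1).totallyBounded.subset subset_closure
  obtain ⟨s, hs, hsub⟩ := Metric.totallyBounded_iff.1 h1 (t / 2) (by positivity)
  by_contra hinf
  have hmem : ∀ i, ∃ y ∈ s, A (e i) ∈ Metric.ball y (t / 2) := fun i => by
    obtain ⟨y, hy, h⟩ := Set.mem_iUnion₂.1 (hsub ⟨e i, by simp [he.1 i], rfl⟩)
    exact ⟨y, hy, h⟩
  choose g hg hg' using hmem
  obtain ⟨i, hi, j, hj, hij, hgij⟩ :=
    Set.Infinite.exists_ne_map_eq_of_mapsTo hinf (fun i _ => hg i : Set.MapsTo g _ s) hs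
  have h2 : ‖A (e i) - A (e j)‖ < t := by
    rw [← dist_eq_norm]
    have := dist_triangle_right (A (e i)) (A (e j)) (g i)
    have h3 := hg' i
    have h4 := hg' j
    rw [← hgij] at h4
    rw [Metric.mem_ball] at h3 h4
    linarith
  have h3 : ‖A (e i) - A (e j)‖ ^ 2 = μ i ^ 2 + μ j ^ 2 := by
    rw [norm_sub_sq (𝕜 := ℂ), hμ, hμ, inner_smul_left, inner_smul_right, he.2 hij]
    simp [norm_smul, he.1]
  have hi' : (t : ℝ) < μ i := by exact_mod_cast hi
  have ht' : (0 : ℝ) < t := by exact_mod_cast ht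
  nlinarith [norm_nonneg (A (e i) - A (e j)), sq_nonneg ((μ j : ℝ))]

variable [CompleteSpace H]

theorem abs_isPositive (x : H →L[ℂ] H) : (CFC.abs x : H →L[ℂ] H).IsPositive :=
  (ContinuousLinearMap.nonneg_iff_isPositive _).1 (CFC.abs_nonneg x)

theorem inner_abs_abs (x : H →L[ℂ] H) (u v : H) :
    inner ℂ (CFC.abs x u) (CFC.abs x v) = inner ℂ (x u) (x v) := by
  have h := congrArg (fun T : H →L[ℂ] H => inner ℂ u (T v)) (CFC.abs_mul_abs x)
  simp only [mul_apply_eq_comp, ContinuousLinearMap.star_eq_adjoint,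
    ContinuousLinearMap.adjoint_inner_right] at h
  rw [← h]
  exact (abs_isPositive x).isSymmetric u _

theorem norm_abs_apply (x : H →L[ℂ] H) (v : H) : ‖CFC.abs x v‖ = ‖x v‖ := by
  rw [norm_eq_sqrt_re_inner (𝕜 := ℂ), norm_eq_sqrt_re_inner (𝕜 := ℂ), inner_abs_abs]

/-- Since ‖|x|v‖ = ‖xv‖, a finite net of the image of the ball under x, lifted to the ball, gives a
net for |x|. No polar decomposition is needed. -/
theorem isCompactOperator_abs {x : H →L[ℂ] H} (hx : IsCompactOperator x) :
    IsCompactOperator (CFC.abs x : H →L[ℂ] H) := by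
  have h1 := (hx.isCompact_closure_image_closedBall (𝕜₁ := ℂ) (f := (x : H →ₗ[ℂ] H)) 1).totallyBounded.subset
    subset_closure
  refine (isCompactOperator_iff_isCompact_closure_image_closedBall (𝕜₁ := ℂ)
    ((CFC.abs x : H →L[ℂ] H) : H →ₗ[ℂ] H) one_pos).2 ?_
  refine TotallyBounded.isCompact_of_isClosed ?_ isClosed_closure
  refine TotallyBounded.closure ?_
  rw [Metric.totallyBounded_iff]
  intro ε hε
  obtain ⟨t, hts, htf, ht⟩ := Metric.finite_approx_of_totallyBounded h1 ε hε
  choose! g hg hg' using fun y (hy : y ∈ t) => hts hy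
  refine ⟨(fun y => CFC.abs x (g y)) '' t, htf.image _, ?_⟩
  rintro _ ⟨v, hv, rfl⟩
  obtain ⟨y, hy, hvy⟩ := Set.mem_iUnion₂.1 (ht ⟨v, hv, rfl⟩)
  refine Set.mem_iUnion₂.2 ⟨_, ⟨y, hy, rfl⟩, ?_⟩
  have e : y = x (g y) := (hg' y hy).symm
  rw [Metric.mem_ball, dist_eq_norm] at hvy ⊢
  rw [e] at hvy
  simp only [ContinuousLinearMap.coe_coe] at hvy ⊢
  rw [← map_sub, norm_abs_apply, map_sub]
  exact hvy

theorem hasSum_orthonormal_sub_mem {ι : Type*} {e : ι → H} (he : Orthonormal ℂ e) (v : H) :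
    ∃ p, HasSum (fun i => inner ℂ (e i) v • e i) p ∧ ∀ i, inner ℂ (e i) (v - p) = 0 := by
  have hs : Summable fun i => inner ℂ (e i) v • e i := by
    have := (he.orthogonalFamily.summable_iff_norm_sq_summable fun i => inner ℂ (e i) v).2
      (he.inner_products_summable v)
    simpa using this
  obtain ⟨p, hp⟩ := hs
  refine ⟨p, hp, fun i => ?_⟩
  have h1 := hp.mapL (innerSL ℂ (e i))
  have h2 : HasSum (fun j => innerSL ℂ (e i) (inner ℂ (e j) v • e j)) (inner ℂ (e i) v) := by
    convert hasSum_single i fun j hj => ?_ using 1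
    · simp [inner_self_eq_norm_sq_to_K, he.1 i]
    · simp [he.2 hj.symm]
  rw [inner_sub_right, sub_eq_zero]
  exact h2.unique h1

/-- Singular value decomposition of a compact operator. -/
theorem exists_singular_decomposition {x : H →L[ℂ] H} (hx : IsCompactOperator x) :
    ∃ (ι : Type) (μ : ι → ℝ≥0) (e f : ι → H), Orthonormal ℂ e ∧ Orthonormal ℂ f ∧
      (∀ v, HasSum (fun i => ((μ i : ℂ) • InnerProductSpace.rankOne ℂ (f i) (e i)) v) (x v)) ∧
      (∀ φ : ℝ≥0 → ℝ≥0∞, φ 0 = 0 → ∑' n, φ (singularValue x n) = ∑' i, φ (μ i)) := by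
  classical
  set A : H →L[ℂ] H := CFC.abs x
  have hA : IsCompactOperator A := isCompactOperator_abs hx
  have hpos : A.IsPositive := abs_isPositive x
  have hsym : (A : H →ₗ[ℂ] H).IsSymmetric := hpos.isSymmetric
  let E : {c : ℝ≥0 // 0 < c} → Submodule ℂ H := fun c =>
    Module.End.eigenspace (A : H →ₗ[ℂ] H) (((c : ℝ≥0) : ℝ) : ℂ)
  have hEfin : ∀ c, FiniteDimensional ℂ (E c) := fun c =>
    ContinuousLinearMap.finite_dimensional_eigenspace hA _ (by
      have := c.2.ne'
      exact_mod_cast this)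
  have hEorth : OrthogonalFamily ℂ (fun c => E c) fun c => (E c).subtypeₗᵢ :=
    hsym.orthogonalFamily_eigenspaces.comp (γ := {c : ℝ≥0 // 0 < c})
      (f := fun c => (((c : ℝ≥0) : ℝ) : ℂ)) (fun c d h => by
        have : ((c : ℝ≥0) : ℝ) = ((d : ℝ≥0) : ℝ) := Complex.ofReal_injective h
        exact Subtype.ext (NNReal.coe_injective this))
  let b : ∀ c, OrthonormalBasis (Fin (Module.finrank ℂ (E c))) ℂ (E c) := fun c =>
    stdOrthonormalBasis ℂ (E c)
  -- One index per positive eigenvalue and vector of an orthonormal basis of its finite-dimensional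
  -- eigenspace.
  let ι : Type := Σ c : {c : ℝ≥0 // 0 < c}, Fin (Module.finrank ℂ (E c))
  let μ : ι → ℝ≥0 := fun i => i.1
  let e : ι → H := fun i => (b i.1 i.2 : H)
  have hμpos : ∀ i, 0 < μ i := fun i => i.1.2
  have hμne : ∀ i, ((μ i : ℝ) : ℂ) ≠ 0 := fun i => by exact_mod_cast (hμpos i).ne'
  have he : Orthonormal ℂ e := hEorth.orthonormal_sigma_orthonormal fun c => (b c).orthonormal
  have hmem : ∀ i, e i ∈ E i.1 := fun i => (b i.1 i.2).2
  have hAe : ∀ i, A (e i) = ((μ i : ℝ) : ℂ) • e i := fun i =>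
    Module.End.mem_eigenspace_iff.1 (hmem i)
  have hEspan : ∀ c, ∀ v ∈ E c, v ∈ Submodule.span ℂ (Set.range fun k => e ⟨c, k⟩) := by
    intro c v hv
    have h := congrArg Subtype.val ((b c).sum_repr ⟨v, hv⟩)
    simp only [AddSubmonoidClass.coe_finsetSum, SetLike.val_smul] at h
    rw [← h]
    exact Submodule.sum_mem _ fun k _ => Submodule.smul_mem _ _ (Submodule.subset_span ⟨k, rfl⟩)
  let f : ι → H := fun i => ((μ i : ℝ) : ℂ)⁻¹ • x (e i)
  have hxe : ∀ i, x (e i) = ((μ i : ℝ) : ℂ) • f i := fun i => by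
    simp only [f]
    rw [smul_inv_smul₀ (hμne i)]
  have hinner : ∀ i j, inner ℂ (f i) (f j) = inner ℂ (e i) (e j) := fun i j => by
    simp only [f, inner_smul_left, inner_smul_right, map_inv₀, Complex.conj_ofReal]
    rw [← inner_abs_abs, hAe, hAe, inner_smul_left, inner_smul_right, Complex.conj_ofReal]
    have h1 := hμne i
    have h2 := hμne j
    field_simp
  have hf : Orthonormal ℂ f := by
    rw [orthonormal_iff_ite] at he ⊢
    exact fun i j => (hinner i j).trans (he i j)
  refine ⟨ι, μ, e, f, he, hf, fun v => ?_, fun φ h0 => ?_⟩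
  · obtain ⟨p, hp, horth⟩ := hasSum_orthonormal_sub_mem he v
    -- The eigenspaces of the compact symmetric operator A are total, so it suffices to test against
    -- eigenvectors w. For eigenvalue 0 this is trivial; otherwise w lies in the span of the eᵢ,
    -- which is orthogonal to v - p.
    have hA0 : A (v - p) = 0 := by
      have hbot := ContinuousLinearMap.orthogonalComplement_iSup_eigenspaces_eq_bot hA hsym
      rw [← Submodule.mem_bot ℂ, ← hbot, ← Submodule.iInf_orthogonal, Submodule.mem_iInf]
      intro c
      rw [Submodule.mem_orthogonal]
      intro w hw
      have hAw : A w = c • w := Module.End.mem_eigenspace_iff.1 hw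
      rcases eq_or_ne w 0 with rfl | hw0
      · simp
      have hsw : inner ℂ w (A (v - p)) = inner ℂ (A w) (v - p) := (hsym w (v - p)).symm
      rw [hsw]
      have hcre : 0 ≤ c := by
        have h1 : 0 ≤ inner ℂ w (A w) := hpos.inner_nonneg_right w
        rw [hAw, inner_smul_right, inner_self_eq_norm_sq_to_K] at h1
        have h2 : (0 : ℂ) ≤ (((‖w‖ ^ 2)⁻¹ : ℝ) : ℂ) := by
          rw [Complex.zero_le_real]
          positivity
        have h3 : ((‖w‖ : ℝ) : ℂ) ≠ 0 := by simpa using hw0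
        have h4 := mul_nonneg h1 h2
        have e1 : c * (RCLike.ofReal ‖w‖ : ℂ) ^ 2 * (((‖w‖ ^ 2)⁻¹ : ℝ) : ℂ) = c := by
          push_cast
          exact mul_inv_cancel_right₀ (pow_ne_zero 2 h3) c
        rwa [e1] at h4
      obtain ⟨r, hr, rfl⟩ : ∃ r : ℝ≥0, 0 ≤ r ∧ c = ((r : ℝ) : ℂ) := by
        obtain ⟨h1, h2⟩ := Complex.le_def.1 hcre
        exact ⟨⟨c.re, h1⟩, zero_le, Complex.ext rfl (by simpa using h2.symm)⟩
      rcases eq_or_ne r 0 with rfl | hr0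
      · rw [hAw]; simp
      have hspan := hEspan ⟨r, pos_iff_ne_zero.2 hr0⟩ w hw
      rw [hAw, inner_smul_left]
      refine mul_eq_zero_of_right _ ?_
      have hle : Submodule.span ℂ (Set.range fun k => e ⟨⟨r, pos_iff_ne_zero.2 hr0⟩, k⟩) ≤
          (ℂ ∙ (v - p))ᗮ := by
        rw [Submodule.span_le]
        rintro _ ⟨k, rfl⟩
        exact Submodule.mem_orthogonal_singleton_iff_inner_left.2 (horth _)
      exact Submodule.mem_orthogonal_singleton_iff_inner_left.1 (hle hspan)
    have hxp : x v = x p := by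
      rw [← sub_eq_zero, ← map_sub, ← norm_eq_zero, ← norm_abs_apply]
      exact norm_eq_zero.2 hA0
    rw [hxp]
    convert hp.mapL x using 2 with i
    simp only [smul_apply, InnerProductSpace.rankOne_apply, map_smul, hxe]
    rw [smul_comm]
  · have habove : ∀ t, eigenspaceAbove x t =
        Submodule.span ℂ (Set.range fun i : {i | t < μ i} => e i) := by
      intro t
      refine le_antisymm ?_ ?_
      · refine iSup_le fun c => iSup_le fun hc v hv => ?_
        have hc0 : 0 < c := lt_of_le_of_lt zero_le hc
        refine Submodule.span_mono ?_ (hEspan ⟨c, hc0⟩ v hv)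
        rintro _ ⟨k, rfl⟩
        exact ⟨⟨⟨⟨c, hc0⟩, k⟩, hc⟩, rfl⟩
      · rw [Submodule.span_le]
        rintro _ ⟨⟨i, hi⟩, rfl⟩
        exact Submodule.mem_iSup_of_mem (μ i) (Submodule.mem_iSup_of_mem hi (hmem i))
    have hrank : ∀ t (n : ℕ), Module.rank ℂ (eigenspaceAbove x t) ≤ (n : Cardinal) ↔
        Cardinal.mk {i | t < μ i} ≤ (n : Cardinal) := by
      intro t n
      have hli : LinearIndependent ℂ fun i : {i | t < μ i} => e i :=
        he.linearIndependent.comp _ Subtype.val_injective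
      rw [habove, rank_span hli, ← Cardinal.lift_le.{0}, Cardinal.mk_range_eq_of_injective hli.injective,
        Cardinal.lift_natCast, ← Cardinal.lift_natCast.{_, 0}, Cardinal.lift_le]
    have hs : ∀ n, singularValue x n = sInf {t : ℝ≥0 | Cardinal.mk {i | t < μ i} ≤ (n : Cardinal)} :=
      fun n => by
        simp only [singularValue, hrank]
    simp only [hs]
    exact tsum_decreasing_enumeration (fun t ht => finite_setOf_lt_of_orthonormal hA he hAe ht) h0

end Singular

/-! ### The modular of an operator and the trace formula. -/

section OperatorModular

variable {H : Type*} [NormedAddCommGroup H] [InnerProductSpace ℂ H] {φ : ℝ≥0 → ℝ≥0∞}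

/-- The absolute value of the sesquilinear form of an operator. -/
noncomputable def absForm (x : H →L[ℂ] H) (u v : H) : ℝ≥0 := ‖inner ℂ u (x v)‖₊

theorem absForm_smul (c : ℂ) (x : H →L[ℂ] H) (u v : H) :
    absForm (c • x) u v = ‖c‖₊ * absForm x u v := by
  simp [absForm]

theorem absForm_add_le (x y : H →L[ℂ] H) (u v : H) :
    absForm (x + y) u v ≤ absForm x u v + absForm y u v := by
  simp only [absForm, add_apply, inner_add_right]
  exact nnnorm_add_le _ _

theorem modular_absForm_smul (φ : ℝ≥0 → ℝ≥0∞) (c : ℂ) (x : H →L[ℂ] H) :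
    modular φ (absForm (c • x)) = modular φ fun u v => ‖c‖₊ * absForm x u v := by
  congr 1
  ext u v : 2
  exact absForm_smul c x u v

/-- One-element families already control the operator norm: φ(|⟪u, x v⟫|) ≤ 1 < φ(C) for all u, v in
the unit ball. -/
theorem norm_le_of_modular_le_one {C : ℝ≥0} (hφ : Monotone φ) (hC : 1 < φ C) {x : H →L[ℂ] H}
    (hx : modular φ (absForm x) ≤ 1) : ‖x‖ ≤ C := by
  have key : ∀ u v : H, ‖u‖ ≤ 1 → ‖v‖ ≤ 1 → ‖inner ℂ u (x v)‖ ≤ C := fun u v hu hv => by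
    have h1 : φ (absForm x u v) < φ C := ((apply_le_modular φ _ hu hv).trans hx).trans_lt hC
    exact_mod_cast (hφ.reflect_lt h1).le
  refine x.opNorm_le_bound C.2 fun v => ?_
  rcases eq_or_ne v 0 with rfl | hv
  · simp
  rcases eq_or_ne (x v) 0 with h0 | h0
  · rw [h0, norm_zero]
    exact mul_nonneg C.2 (norm_nonneg _)
  have hv' : 0 < ‖v‖ := norm_pos_iff.2 hv
  have hx' : 0 < ‖x v‖ := norm_pos_iff.2 h0
  have h := key (((‖x v‖⁻¹ : ℝ) : ℂ) • x v) (((‖v‖⁻¹ : ℝ) : ℂ) • v)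
    (by simp [norm_smul, hx'.ne']) (by simp [norm_smul, hv'.ne'])
  rw [map_smul, inner_smul_left, inner_smul_right, inner_self_eq_norm_sq_to_K] at h
  simp only [norm_mul, Complex.norm_real, norm_inv, norm_norm, Complex.conj_ofReal, norm_pow,
    Complex.coe_algebraMap] at h
  have e : ‖x v‖⁻¹ * (‖v‖⁻¹ * ‖x v‖ ^ 2) = ‖x v‖ / ‖v‖ := by field_simp
  rw [e, div_le_iff₀ hv'] at h
  exact h

theorem isCompactOperator_rankOne (a b : H) :
    IsCompactOperator (InnerProductSpace.rankOne ℂ a b : H →L[ℂ] H) := by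
  rw [InnerProductSpace.rankOne_def']
  have h1 : IsCompactOperator (id : ℂ → ℂ) :=
    (isCompactOperator_id_iff_finiteDimensional (𝕜 := ℂ)).2 inferInstance
  exact (h1.clm_comp (ContinuousLinearMap.toSpanSingleton ℂ a)).comp_clm (innerSL ℂ b)

theorem isCompactOperator_starProjection (U : Submodule ℂ H) [FiniteDimensional ℂ U] :
    IsCompactOperator (U.starProjection : H →L[ℂ] H) := by
  have h1 : IsCompactOperator (id : U → U) :=
    (isCompactOperator_id_iff_finiteDimensional (𝕜 := ℂ)).2 inferInstance
  exact (h1.clm_comp U.subtypeL).comp_clm U.orthogonalProjectionOnto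

/-- Contractions move from the operator onto the test families, which remain Bessel. -/
theorem modular_absForm_comp_le [CompleteSpace H] (φ : ℝ≥0 → ℝ≥0∞) {a b : H →L[ℂ] H} (ha : ‖a‖ ≤ 1)
    (hb : ‖b‖ ≤ 1) (c : ℝ≥0) (x : H →L[ℂ] H) :
    modular φ (fun u v => c * absForm (a ∘L x ∘L b) u v) ≤ modular φ fun u v => c * absForm x u v := by
  refine modular_le fun n u v hu hv => ?_
  have hv' := hv.adjoint (a := ContinuousLinearMap.adjoint b)
    (by rwa [LinearIsometryEquiv.norm_map])
  rw [ContinuousLinearMap.adjoint_adjoint] at hv'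
  refine le_trans (le_of_eq ?_) (le_modular φ _ (hu.adjoint ha) hv')
  simp [absForm, ContinuousLinearMap.adjoint_inner_left]

/-- Operators with finite modular are compact when `φ` satisfies `δ₂`. -/
theorem IsOrlicz.isCompactOperator [CompleteSpace H] (hφ : IsOrlicz φ) (h2 : DeltaTwoZero φ)
    {x : H →L[ℂ] H} (hx : modular φ (absForm x) ≠ ∞) : IsCompactOperator x := by
  obtain ⟨C, hC⟩ := hφ.exists_one_lt
  have hcl := isClosed_setOfPred_isCompactOperator (𝕜₁ := ℂ) (σ₁₂ := RingHom.id ℂ) (M₁ := H) (M₂ := H)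
  have hmem : x ∈ closure {f : H →L[ℂ] H | IsCompactOperator f} := by
    rw [Metric.mem_closure_iff]
    intro ε hε
    -- The cut-off operator y will satisfy 2ᵐ‖y‖ ≤ C, hence ‖y‖ < ε, while x - y is a sum of
    -- compositions with finite-rank projections.
    obtain ⟨m, hm⟩ := pow_unbounded_of_one_lt (C / ε) one_lt_two
    obtain ⟨δ, hδ, H1⟩ := h2.exists_modular_scale_le_one (H := H) hφ.mono hφ.pos m
    obtain ⟨U, V, hU, hV, hUV⟩ := exists_modular_cutoff_le hx hδ
    set y : H →L[ℂ] H := Uᗮ.starProjection ∘L x ∘L Vᗮ.starProjection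
    have hy : modular φ (absForm ((2 ^ m : ℂ) • y)) ≤ 1 := by
      rw [modular_absForm_smul]
      refine le_of_eq_of_le ?_ (H1 _ hUV)
      congr 1
      ext u v : 2
      simp only [absForm, y, ContinuousLinearMap.comp_apply, nnnorm_pow,
        Submodule.inner_starProjection_left_eq_right, show ‖(2 : ℂ)‖₊ = 2 by simp]
    have hn := norm_le_of_modular_le_one hφ.mono hC hy
    rw [norm_smul] at hn
    have hy2 : ‖y‖ < ε := by
      simp only [norm_pow, Complex.norm_ofNat] at hn
      rw [div_lt_iff₀ hε] at hm
      by_contra! hle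
      have : (2 : ℝ) ^ m * ε ≤ 2 ^ m * ‖y‖ := by gcongr
      linarith
    refine ⟨x - y, ?_, by simpa [dist_eq_norm] using hy2⟩
    have e : x - y = x ∘L V.starProjection + U.starProjection ∘L (x ∘L Vᗮ.starProjection) := by
      ext v
      simp only [y, Submodule.starProjection_orthogonal, sub_apply, add_apply,
        ContinuousLinearMap.comp_apply, ContinuousLinearMap.id_apply, map_sub]
      abel
    rw [Set.mem_ofPred_eq, e]
    exact ((isCompactOperator_starProjection V).clm_comp x).add
      ((isCompactOperator_starProjection U).comp_clm (x ∘L Vᗮ.starProjection))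
  rwa [hcl.closure_eq] at hmem

theorem IsOrlicz.modular_absForm_le_tsum (hφ : IsOrlicz φ) {ι : Type*} {e f : ι → H}
    (he : Orthonormal ℂ e) (hf : Orthonormal ℂ f) (μ : ι → ℝ≥0) {x : H →L[ℂ] H}
    (hx : ∀ v, HasSum (fun i => ((μ i : ℂ) • InnerProductSpace.rankOne ℂ (f i) (e i)) v) (x v)) :
    modular φ (absForm x) ≤ ∑' i, φ (μ i) := by
  refine modular_le_of_tendsto (l := Filter.atTop) (α := Finset ι) hφ.cont
    (F := fun s u v => ‖inner ℂ u (∑ i ∈ s, ((μ i : ℂ) • InnerProductSpace.rankOne ℂ (f i) (e i)) v)‖₊)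
    (fun u v => ((continuous_const.inner continuous_id).nnnorm.tendsto _).comp (hx v)) fun s => ?_
  refine (hφ.modular_le_sum (Orthonormal.isBessel he s) (Orthonormal.isBessel hf s)
    (fun i => μ i) fun a b => ?_).trans ?_
  · rw [inner_sum, Finset.sum_coe_sort s fun i => μ i * (‖inner ℂ a (f i)‖₊ * ‖inner ℂ (e i) b‖₊)]
    refine (nnnorm_sum_le _ _).trans_eq (Finset.sum_congr rfl fun i _ => ?_)
    rw [smul_apply, InnerProductSpace.rankOne_apply, inner_smul_right, inner_smul_right,
      nnnorm_mul, nnnorm_mul, mul_comm ‖inner ℂ (e i) b‖₊]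
    simp
  · rw [Finset.sum_coe_sort s fun i => φ (μ i)]
    exact ENNReal.sum_le_tsum s

theorem apply_eq_of_hasSum_rankOne {ι : Type*} {e f : ι → H}
    (he : Orthonormal ℂ e) {μ : ι → ℝ≥0} {x : H →L[ℂ] H}
    (hx : ∀ v, HasSum (fun i => ((μ i : ℂ) • InnerProductSpace.rankOne ℂ (f i) (e i)) v) (x v))
    (i : ι) : x (e i) = (μ i : ℂ) • f i := by
  refine (hx (e i)).unique ?_
  convert hasSum_single i fun j hj => ?_ using 1
  · simp [inner_self_eq_norm_sq_to_K, he.1 i]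
  · simp [he.2 hj]

theorem tsum_le_modular_absForm {ι : Type*} {e f : ι → H}
    (he : Orthonormal ℂ e) (hf : Orthonormal ℂ f) {μ : ι → ℝ≥0} {x : H →L[ℂ] H}
    (hx : ∀ v, HasSum (fun i => ((μ i : ℂ) • InnerProductSpace.rankOne ℂ (f i) (e i)) v) (x v)) :
    ∑' i, φ (μ i) ≤ modular φ (absForm x) := by
  rw [ENNReal.tsum_eq_iSup_sum]
  refine iSup_le fun s => ?_
  refine le_of_eq_of_le ?_
    (le_modular φ (absForm x) (Orthonormal.isBessel hf s) (Orthonormal.isBessel he s))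
  rw [← Finset.sum_coe_sort s fun i => φ (μ i)]
  refine Finset.sum_congr rfl fun i _ => ?_
  rw [absForm, apply_eq_of_hasSum_rankOne he hx, inner_smul_right, inner_self_eq_norm_sq_to_K,
    hf.1]
  simp

/-- The trace `Tr φ(|x|)` is the variational modular. -/
theorem IsOrlicz.tsum_singularValue [CompleteSpace H] (hφ : IsOrlicz φ) {x : H →L[ℂ] H}
    (hx : IsCompactOperator x) :
    ∑' n, φ (singularValue x n) = modular φ (absForm x) := by
  obtain ⟨ι, μ, e, f, he, hf, h, hs⟩ := exists_singular_decomposition hx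
  rw [hs φ hφ.map_zero]
  exact le_antisymm (tsum_le_modular_absForm he hf h) (hφ.modular_absForm_le_tsum he hf μ h)

end OperatorModular

/-! ### Helly's approximation theorem. -/

section Bidual

theorem le_mul_of_forall_lt {a b C : ℝ} (hC : 0 ≤ C) (h : ∀ r, b < r → a ≤ C * r) : a ≤ C * b := by
  refine le_of_forall_pos_le_add fun ε hε => ?_
  have h1 := h (b + ε / (C + 1)) (lt_add_of_pos_right _ (by positivity))
  have h2 : C * (ε / (C + 1)) ≤ ε := by
    rw [mul_div_assoc', div_le_iff₀ (by positivity)]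
    nlinarith
  linarith

theorem exists_norm_one_mul_eq_norm (w : ℂ) : ∃ θ : ℂ, ‖θ‖ = 1 ∧ θ * w = (‖w‖ : ℂ) := by
  rcases eq_or_ne w 0 with rfl | hw
  · exact ⟨1, by simp, by simp⟩
  · have h : (‖w‖ : ℂ) ≠ 0 := by simpa using hw
    refine ⟨(‖w‖ : ℂ) / w, ?_, by field_simp⟩
    simp [hw]

variable {V : Type*} [NormedAddCommGroup V] [NormedSpace ℂ V]

/-- Helly's form of Goldstine's theorem: finitely many values of a functional in the unit ball of
the bidual are approximated by values at points of the unit ball. -/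
theorem mem_closure_image_ball {z : StrongDual ℂ (StrongDual ℂ V)} (hz : ‖z‖ ≤ 1) {n : ℕ}
    (F : Fin n → StrongDual ℂ V) :
    (fun j => z (F j)) ∈ closure ((fun y j => F j y : V → Fin n → ℂ) '' Metric.ball 0 1) := by
  by_contra hmem
  have hconv : Convex ℝ (closure ((fun y j => F j y : V → Fin n → ℂ) '' Metric.ball 0 1)) := by
    refine Convex.closure ?_
    exact (convex_ball (0 : V) 1).linear_image
      ((LinearMap.pi fun j => (F j : V →ₗ[ℂ] ℂ)).restrictScalars ℝ)
  obtain ⟨l, u, hl, hu⟩ :=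
    RCLike.geometric_hahn_banach_closed_point (𝕜 := ℂ) hconv isClosed_closure hmem
  -- The separating functional on ℂⁿ pulls back to g, with ‖g‖ ≤ u on rotating phases, whereas Re
  -- z(g) > u. This contradicts ‖z‖ ≤ 1.
  set g : StrongDual ℂ V := ∑ j, l (Pi.single j 1) • F j
  have hl' : ∀ w : Fin n → ℂ, l w = ∑ j, l (Pi.single j 1) * w j := fun w => by
    conv_lhs => rw [pi_eq_sum_univ' w]
    rw [map_sum]
    refine Finset.sum_congr rfl fun j _ => ?_
    rw [map_smul, smul_eq_mul, mul_comm]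
  have hg : ∀ y, g y = l fun j => F j y := fun y => by
    rw [hl']
    simp [g]
  have hzg : z g = l fun j => z (F j) := by
    rw [hl']
    simp [g]
  have hlt : ∀ y, ‖y‖ < 1 → ‖g y‖ ≤ u := fun y hy => by
    obtain ⟨θ, hθ, h⟩ := exists_norm_one_mul_eq_norm (g y)
    have h1 := hl _ (subset_closure ⟨θ • y, by simpa [norm_smul, hθ] using hy, rfl⟩)
    rw [← hg, map_smul, smul_eq_mul, h] at h1
    simpa using h1.le
  have hu0 : 0 ≤ u := (norm_nonneg _).trans (hlt 0 (by simp))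
  have hgn : ‖g‖ ≤ u := by
    refine g.opNorm_le_bound hu0 fun y => le_mul_of_forall_lt hu0 fun r hr => ?_
    have hr0 : 0 < r := (norm_nonneg y).trans_lt hr
    have h1 := hlt (((r⁻¹ : ℝ) : ℂ) • y) (by
      rw [norm_smul, Complex.norm_real, Real.norm_of_nonneg (by positivity),
        inv_mul_lt_iff₀ hr0]
      simpa using hr)
    rw [map_smul, norm_smul, Complex.norm_real, Real.norm_of_nonneg (by positivity),
      inv_mul_le_iff₀ hr0] at h1
    linarith
  have h2 : ‖z g‖ ≤ u := (z.le_opNorm g).trans ((mul_le_of_le_one_left (norm_nonneg _) hz).trans hgn)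
  rw [← hzg] at hu
  exact absurd ((Complex.re_le_norm _).trans h2) (not_le.2 hu)

end Bidual

/-! ### Normed spaces modelled on the Luxemburg norm. -/

section Model

variable {H : Type*} [NormedAddCommGroup H] [InnerProductSpace ℂ H]
  {V : Type*} [NormedAddCommGroup V] [NormedSpace ℂ V] {T : V →ₗ[ℂ] (H →L[ℂ] H)}
  {φ : ℝ≥0 → ℝ≥0∞}

/-- `T` identifies the normed space `V` with the operators of finite `φ`-modular under the
Luxemburg norm. -/
structure IsLuxemburgModel (φ : ℝ≥0 → ℝ≥0∞) (T : V →ₗ[ℂ] (H →L[ℂ] H)) : Prop where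
  injective : Function.Injective T
  isCompactOperator : ∀ y, IsCompactOperator (T y)
  exists_eq : ∀ (A : H →L[ℂ] H) (c : ℝ≥0), IsCompactOperator A → 0 < c →
    modular φ (fun u v => c * absForm A u v) ≠ ∞ → ∃ y, T y = A
  modular_le_one : ∀ y, ‖y‖ < 1 → modular φ (absForm (T y)) ≤ 1
  norm_le_one : ∀ y, modular φ (absForm (T y)) ≤ 1 → ‖y‖ ≤ 1

namespace IsLuxemburgModel

variable (hT : IsLuxemburgModel φ T)
include hT

theorem mul_norm_le_one {c : ℝ≥0} {y : V}
    (h : modular φ (fun u v => c * absForm (T y) u v) ≤ 1) : c * ‖y‖ ≤ 1 := by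
  have h1 := hT.norm_le_one (((c : ℝ) : ℂ) • y) (by
    rw [map_smul, modular_absForm_smul]
    simpa using h)
  rw [norm_smul] at h1
  simpa using h1

theorem modular_inv_mul_le_one {r : ℝ≥0} {y : V} (hr : ‖y‖ < r) :
    modular φ (fun u v => r⁻¹ * absForm (T y) u v) ≤ 1 := by
  have hr0 : (0 : ℝ) < r := (norm_nonneg y).trans_lt hr
  have h1 := hT.modular_le_one ((((r⁻¹ : ℝ≥0) : ℝ) : ℂ) • y) (by
    rw [norm_smul, Complex.norm_real, Real.norm_of_nonneg (by positivity), NNReal.coe_inv,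
      inv_mul_lt_iff₀ hr0]
    simpa using hr)
  rw [map_smul, modular_absForm_smul] at h1
  simpa using h1

theorem norm_le_mul {W : Type*} [NormedAddCommGroup W] [NormedSpace ℂ W] (L : V →ₗ[ℂ] W) {C : ℝ}
    (hC : 0 ≤ C) (h : ∀ y, modular φ (absForm (T y)) ≤ 1 → ‖L y‖ ≤ C) (y : V) :
    ‖L y‖ ≤ C * ‖y‖ := by
  refine le_mul_of_forall_lt hC fun r hr => ?_
  have hr0 : 0 < r := (norm_nonneg y).trans_lt hr
  have h1 := h (((r⁻¹ : ℝ) : ℂ) • y) (hT.modular_le_one _ (by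
    rw [norm_smul, Complex.norm_real, Real.norm_of_nonneg (by positivity), inv_mul_lt_iff₀ hr0]
    simpa using hr))
  rw [map_smul, norm_smul, Complex.norm_real, Real.norm_of_nonneg (by positivity),
    inv_mul_le_iff₀ hr0] at h1
  linarith

theorem exists_continuous (hφ : IsOrlicz φ) : ∃ T' : V →L[ℂ] (H →L[ℂ] H), ∀ y, T' y = T y := by
  obtain ⟨C, hC⟩ := hφ.exists_one_lt
  exact ⟨T.mkContinuous C (hT.norm_le_mul T C.2 fun y hy =>
    norm_le_of_modular_le_one hφ.mono hC hy), fun y => rfl⟩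

/-- Compression by contractions acts on `V`. -/
theorem exists_compression [CompleteSpace H] {a b : H →L[ℂ] H} (ha : ‖a‖ ≤ 1) (hb : ‖b‖ ≤ 1) :
    ∃ M : V →L[ℂ] V, (∀ y, T (M y) = a ∘L T y ∘L b) ∧ ‖M‖ ≤ 1 := by
  have hex : ∀ y, ∃ y', T y' = a ∘L T y ∘L b := fun y => by
    have hr : ‖y‖ < (‖y‖₊ + 1 : ℝ≥0) := by simp
    refine hT.exists_eq _ (‖y‖₊ + 1)⁻¹ (((hT.isCompactOperator y).comp_clm b).clm_comp a)
      (by positivity) ?_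
    exact ((modular_absForm_comp_le φ ha hb _ _).trans
      (hT.modular_inv_mul_le_one hr)).trans_lt ENNReal.one_lt_top |>.ne
  choose m hm using hex
  let M : V →ₗ[ℂ] V :=
    { toFun := m
      map_add' := fun x y => hT.injective (by
        rw [map_add, hm, hm, hm, map_add]
        ext v
        simp)
      map_smul' := fun c y => hT.injective (by
        rw [map_smul, hm, hm, map_smul]
        ext v
        simp) }
  have hM : ∀ y, ‖M y‖ ≤ 1 * ‖y‖ := hT.norm_le_mul M zero_le_one fun y hy => by
    refine hT.norm_le_one _ ?_
    have := modular_absForm_comp_le φ ha hb 1 (T y)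
    simp only [one_mul] at this
    change modular φ (absForm (T (m y))) ≤ 1
    rw [hm]
    exact this.trans hy
  exact ⟨M.mkContinuous 1 hM, hm, M.mkContinuous_norm_le zero_le_one hM⟩

/-- For a, b in the unit ball, the modular of t times the rank-one form is at most φ(t), so any t >
0 with φ(t) ≤ 1 yields the constant t⁻¹. -/
theorem exists_rankOne (hφ : IsOrlicz φ) :
    ∃ D : ℝ, ∀ a b : H, ∃ y, T y = InnerProductSpace.rankOne ℂ a b ∧ ‖y‖ ≤ D * (‖a‖ * ‖b‖) := by
  obtain ⟨t, ht0, ht⟩ : ∃ t : ℝ≥0, 0 < t ∧ φ t ≤ 1 := by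
    have h1 : ∀ᶠ t in nhdsWithin (0 : ℝ≥0) (Set.Ioi 0), φ t < 1 :=
      nhdsWithin_le_nhds ((hφ.cont.tendsto 0).eventually
        (gt_mem_nhds (by rw [hφ.map_zero]; exact one_pos)))
    obtain ⟨t, h, h'⟩ := (h1.and self_mem_nhdsWithin).exists
    exact ⟨t, h', h.le⟩
  have key : ∀ a b : H, ‖a‖ ≤ 1 → ‖b‖ ≤ 1 →
      ∃ y, T y = InnerProductSpace.rankOne ℂ a b ∧ ‖y‖ ≤ (t : ℝ)⁻¹ := fun a b ha hb => by
    have hm : modular φ (fun u v => t * absForm (InnerProductSpace.rankOne ℂ a b) u v) ≤ 1 := by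
      refine le_trans ?_ ht
      refine (hφ.modular_le_sum (isBessel_unit hb) (isBessel_unit ha) (fun _ => t)
        fun u v => ?_).trans_eq (by simp)
      simp only [absForm, InnerProductSpace.rankOne_apply, inner_smul_right, nnnorm_mul]
      simp [mul_comm]
    obtain ⟨y, hy⟩ := hT.exists_eq _ t (isCompactOperator_rankOne a b) ht0
      (hm.trans_lt ENNReal.one_lt_top).ne
    refine ⟨y, hy, ?_⟩
    rw [← hy] at hm
    have h1 := hT.mul_norm_le_one hm
    have ht0' : (0 : ℝ) < t := by exact_mod_cast ht0
    rwa [mul_comm, ← le_div_iff₀ ht0', one_div] at h1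
  refine ⟨(t : ℝ)⁻¹, fun a b => ?_⟩
  rcases eq_or_ne a 0 with rfl | ha
  · exact ⟨0, by simp, by simp⟩
  rcases eq_or_ne b 0 with rfl | hb
  · exact ⟨0, by simp, by simp⟩
  have ha' : ‖a‖ ≠ 0 := norm_ne_zero_iff.2 ha
  have hb' : ‖b‖ ≠ 0 := norm_ne_zero_iff.2 hb
  obtain ⟨y, hy, hn⟩ := key (((‖a‖⁻¹ : ℝ) : ℂ) • a) (((‖b‖⁻¹ : ℝ) : ℂ) • b)
    (by simp [norm_smul, ha']) (by simp [norm_smul, hb'])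
  refine ⟨((‖a‖ * ‖b‖ : ℝ) : ℂ) • y, ?_, ?_⟩
  · rw [map_smul, hy]
    ext v
    simp only [smul_apply, InnerProductSpace.rankOne_apply, inner_smul_left, Complex.conj_ofReal,
      smul_smul]
    congr 1
    push_cast
    have h1 : (‖a‖ : ℂ) ≠ 0 := by exact_mod_cast ha'
    have h2 : (‖b‖ : ℂ) ≠ 0 := by exact_mod_cast hb'
    field_simp
  · rw [norm_smul, Complex.norm_real, Real.norm_of_nonneg (by positivity), mul_comm]
    gcongr

end IsLuxemburgModel

end Model

/-! ### Duality between the φ- and ψ-modulars, and points of the bidual. -/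

section Reflexive

variable {H : Type*} [NormedAddCommGroup H] [InnerProductSpace ℂ H]
  {V : Type*} [NormedAddCommGroup V] [NormedSpace ℂ V] {T : V →ₗ[ℂ] (H →L[ℂ] H)}
  {φ : ℝ≥0 → ℝ≥0∞}

/-- The matrix coefficient `y ↦ ⟪u, y v⟫`. -/
noncomputable def coeff (T' : V →L[ℂ] (H →L[ℂ] H)) (u v : H) : StrongDual ℂ V :=
  innerSL ℂ u ∘L ContinuousLinearMap.apply ℂ H v ∘L T'

theorem coeff_apply (T' : V →L[ℂ] (H →L[ℂ] H)) (u v : H) (y : V) :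
    coeff T' u v y = inner ℂ u (T' y v) := rfl

theorem norm_coeff_le (T' : V →L[ℂ] (H →L[ℂ] H)) (u v : H) :
    ‖coeff T' u v‖ ≤ ‖T'‖ * ‖u‖ * ‖v‖ := by
  refine ContinuousLinearMap.opNorm_le_bound _ (by positivity) fun y => ?_
  rw [coeff_apply]
  calc ‖inner ℂ u (T' y v)‖ ≤ ‖u‖ * ‖T' y v‖ := norm_inner_le_norm _ _
    _ ≤ ‖u‖ * (‖T'‖ * ‖y‖ * ‖v‖) := by
        gcongr
        exact (T' y).le_of_opNorm_le (T'.le_opNorm y) v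
    _ = ‖T'‖ * ‖u‖ * ‖v‖ * ‖y‖ := by ring

/-- Functionals of norm at most one have `ψ`-modular at most one. -/
theorem IsLuxemburgModel.modular_complementary_le_one (hT : IsLuxemburgModel φ T)
    (hφ : IsOrlicz φ) {R : H → H → V}
    (hR : ∀ a b, T (R a b) = InnerProductSpace.rankOne ℂ a b) {g : StrongDual ℂ V}
    (hg : ‖g‖ ≤ 1) : modular (complementary φ) (fun u v => ‖g (R u v)‖₊) ≤ 1 := by
  refine modular_le fun n u v hu hv => sum_complementary_le_one hφ.map_zero _ fun t => ?_
  rcases eq_or_ne (∑ j, φ (t j)) ∞ with htop | hfin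
  · simp [htop]
  obtain ⟨S, hS⟩ : ∃ S : ℝ≥0, (S : ℝ≥0∞) = ∑ j, φ (t j) := ⟨_, ENNReal.coe_toNNReal hfin⟩
  rw [← hS, ← ENNReal.coe_one, ← ENNReal.coe_max, ENNReal.coe_le_coe]
  -- Dividing the finite-rank test element y by m brings its modular to at most 1. The phases θⱼ
  -- below make g(y) equal to the nonnegative pairing.
  set m := max 1 S
  have hm1 : 1 ≤ m := le_max_left _ _
  have hm0 : 0 < m := one_pos.trans_le hm1
  choose θ hθ hθg using fun j => exists_norm_one_mul_eq_norm (g (R (u j) (v j)))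
  set y : V := ∑ j, ((t j : ℂ) * θ j) • R (u j) (v j)
  have hform : ∀ a b, absForm (T y) a b ≤ ∑ j, t j * (‖inner ℂ a (u j)‖₊ * ‖inner ℂ (v j) b‖₊) := by
    intro a b
    simp only [absForm, y, map_sum, map_smul, hR, sum_apply, smul_apply,
      InnerProductSpace.rankOne_apply, inner_sum, inner_smul_right]
    refine (nnnorm_sum_le _ _).trans (Finset.sum_le_sum fun j _ => le_of_eq ?_)
    have h1 : ‖θ j‖₊ = 1 := NNReal.eq (hθ j)
    simp only [nnnorm_mul, h1, mul_one]
    rw [mul_comm ‖inner ℂ (v j) b‖₊]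
    simp
  have hmod : modular φ (fun a b => m⁻¹ * absForm (T y) a b) ≤ 1 := by
    refine (hφ.modular_mul_le _ (inv_le_one_of_one_le₀ hm1)).trans ?_
    calc ((m⁻¹ : ℝ≥0) : ℝ≥0∞) * modular φ (absForm (T y)) ≤ ((m⁻¹ : ℝ≥0) : ℝ≥0∞) * S := by
          gcongr
          rw [hS]
          exact hφ.modular_le_sum hv hu t hform
      _ ≤ 1 := by
          rw [← ENNReal.coe_mul]
          norm_cast
          rw [inv_mul_le_iff₀ hm0, mul_one]
          exact le_max_right _ _
  have hy : ‖y‖ ≤ m := by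
    have := hT.mul_norm_le_one hmod
    rwa [NNReal.coe_inv, inv_mul_le_iff₀ (by exact_mod_cast hm0), mul_one] at this
  have hgy : g y = ((∑ j, ‖g (R (u j) (v j))‖₊ * t j : ℝ≥0) : ℂ) := by
    simp only [y, map_sum, map_smul, smul_eq_mul, mul_assoc, hθg]
    push_cast
    exact Finset.sum_congr rfl fun j _ => mul_comm _ _
  have h1 : ‖g y‖ ≤ m := (g.le_of_opNorm_le hg y).trans (by rwa [one_mul])
  rw [hgy, Complex.norm_real, Real.norm_of_nonneg (by positivity)] at h1
  exact_mod_cast h1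

variable [CompleteSpace H]

/-- A functional on the dual is represented on coefficients by an operator. -/
theorem exists_operator_of_bidual (T' : V →L[ℂ] (H →L[ℂ] H))
    (z : StrongDual ℂ (StrongDual ℂ V)) :
    ∃ x : H →L[ℂ] H, ∀ u v, z (coeff T' u v) = inner ℂ u (x v) := by
  let B₀ : H →ₗ⋆[ℂ] H →ₗ[ℂ] ℂ := LinearMap.mk₂'ₛₗ (starRingEnd ℂ) (RingHom.id ℂ)
    (fun u v => z (coeff T' u v))
    (fun u u' v => by
      rw [← map_add]; congr 1; ext y; simp [coeff_apply])
    (fun c u v => by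
      rw [smul_eq_mul, ← smul_eq_mul, ← map_smul]; congr 1; ext y
      simp [coeff_apply, mul_comm])
    (fun u v v' => by
      rw [← map_add]; congr 1; ext y; simp [coeff_apply])
    (fun c u v => by
      rw [RingHom.id_apply, ← map_smul]; congr 1; ext y
      simp [coeff_apply])
  let B : H →L⋆[ℂ] H →L[ℂ] ℂ := B₀.mkContinuous₂ (‖z‖ * ‖T'‖) fun u v => by
    calc ‖z (coeff T' u v)‖ ≤ ‖z‖ * ‖coeff T' u v‖ := z.le_opNorm _
      _ ≤ ‖z‖ * (‖T'‖ * ‖u‖ * ‖v‖) := by gcongr; exact norm_coeff_le T' u v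
      _ = ‖z‖ * ‖T'‖ * ‖u‖ * ‖v‖ := by ring
  -- The operator attached to B represents it in the first slot of the inner product; the adjoint
  -- moves it to the second.
  refine ⟨ContinuousLinearMap.adjoint (InnerProductSpace.continuousLinearMapOfBilin B),
    fun u v => ?_⟩
  rw [ContinuousLinearMap.adjoint_inner_right, InnerProductSpace.continuousLinearMapOfBilin_apply]
  rfl

namespace IsLuxemburgModel

variable (hT : IsLuxemburgModel φ T)
include hT

/-- For fixed test families the bound ∑ φ ≤ 1 is a closed condition on finitely many coefficients,
so it passes from the unit ball to z. Compactness of the resulting operator then comes from δ₂. -/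
theorem exists_point_of_bidual (hφ : IsOrlicz φ) (h2 : DeltaTwoZero φ) {T' : V →L[ℂ] (H →L[ℂ] H)}
    (hT' : ∀ y, T' y = T y) {z : StrongDual ℂ (StrongDual ℂ V)} (hz : ‖z‖ ≤ 1) :
    ∃ y, ∀ u v, z (coeff T' u v) = coeff T' u v y := by
  obtain ⟨x, hx⟩ := exists_operator_of_bidual T' z
  have hmod : modular φ (absForm x) ≤ 1 := by
    refine modular_le fun n u v hu hv => ?_
    have hclosed : IsClosed {w : Fin n → ℂ | ∑ j, φ ‖w j‖₊ ≤ 1} := by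
      refine isClosed_le (continuous_finsetSum _ fun j _ => ?_) continuous_const
      exact hφ.cont.comp (continuous_apply j).nnnorm
    have hsub : closure ((fun y j => coeff T' (u j) (v j) y : V → Fin n → ℂ) '' Metric.ball 0 1) ⊆
        {w : Fin n → ℂ | ∑ j, φ ‖w j‖₊ ≤ 1} := by
      refine closure_minimal ?_ hclosed
      rintro _ ⟨y, hy, rfl⟩
      have h1 := le_modular φ (absForm (T y)) hu hv
      have h3 : ‖y‖ < 1 := by simpa using hy
      have h4 := h1.trans (hT.modular_le_one y h3)
      simp only [Set.mem_ofPred_eq, coeff_apply, hT']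
      exact h4
    have h1 : ∑ j, φ ‖z (coeff T' (u j) (v j))‖₊ ≤ 1 :=
      hsub (mem_closure_image_ball hz fun j => coeff T' (u j) (v j))
    simp only [hx] at h1
    exact h1
  have hfin : modular φ (absForm x) ≠ ∞ := (hmod.trans_lt ENNReal.one_lt_top).ne
  obtain ⟨y, hy⟩ := hT.exists_eq x 1 (hφ.isCompactOperator h2 hfin) one_pos (by simpa using hfin)
  exact ⟨y, fun u v => by rw [hx, coeff_apply, hT', hy]⟩

/-- Finite-rank truncations of the singular value decomposition converge. -/
theorem exists_rankOne_approx (hφ : IsOrlicz φ) (h2 : DeltaTwoZero φ) {R : H → H → V}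
    (hR : ∀ a b, T (R a b) = InnerProductSpace.rankOne ℂ a b) {y : V}
    (hy : modular φ (absForm (T y)) ≤ 1) {ε : ℝ} (hε : 0 < ε) :
    ∃ (ι : Type) (_ : Fintype ι) (μ : ι → ℝ≥0) (e f : ι → H), IsBessel e ∧ IsBessel f ∧
      ∑ i, φ (μ i) ≤ 1 ∧ ‖y - ∑ i, (μ i : ℂ) • R (f i) (e i)‖ ≤ ε := by
  classical
  obtain ⟨κ, μ, e, f, he, hf, h, -⟩ := exists_singular_decomposition (hT.isCompactOperator y)
  have hsum : ∑' i, φ (μ i) ≤ 1 := (tsum_le_modular_absForm he hf h).trans hy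
  obtain ⟨m, hm⟩ := pow_unbounded_of_one_lt (1 / ε) one_lt_two
  obtain ⟨δ, hδ, H1⟩ := h2.exists_modular_scale_le_one (H := H) hφ.mono hφ.pos m
  obtain ⟨s, hs⟩ := ((ENNReal.tendsto_tsum_compl_atTop_zero
    (hsum.trans_lt ENNReal.one_lt_top).ne).eventually (gt_mem_nhds hδ)).exists
  refine ⟨s, inferInstance, fun i => μ i, fun i => e i, fun i => f i, Orthonormal.isBessel he s,
    Orthonormal.isBessel hf s, ?_, ?_⟩
  · rw [Finset.sum_coe_sort s fun i => φ (μ i)]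
    exact (ENNReal.sum_le_tsum s).trans hsum
  rw [Finset.sum_coe_sort s fun i => (μ i : ℂ) • R (f i) (e i)]
  set w := y - ∑ i ∈ s, (μ i : ℂ) • R (f i) (e i)
  -- The remainder w keeps the same singular vectors with the coefficients in s set to 0, so its
  -- modular is at most the tail of the series.
  have hw : ∀ v, HasSum (fun i => (((if i ∈ s then 0 else μ i : ℝ≥0) : ℂ) •
      InnerProductSpace.rankOne ℂ (f i) (e i)) v) (T w v) := fun v => by
    have h1 : HasSum (fun i => if i ∈ s then ((μ i : ℂ) •
        InnerProductSpace.rankOne ℂ (f i) (e i)) v else 0)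
        (∑ i ∈ s, ((μ i : ℂ) • InnerProductSpace.rankOne ℂ (f i) (e i)) v) := by
      convert hasSum_sum_of_ne_finset_zero (L := SummationFilter.unconditional κ) (s := s)
        fun i hi => ?_ using 1
      · exact Finset.sum_congr rfl fun i hi => by simp [hi]
      · simp [hi]
    have h3 := (h v).sub h1
    convert h3 using 1
    · ext i
      by_cases hi : i ∈ s <;> simp [hi]
    · simp [w, hR, map_sum]
  have hmod : modular φ (absForm (T w)) ≤ δ := by
    refine (hφ.modular_absForm_le_tsum he hf _ hw).trans (le_trans (le_of_eq ?_) hs.le)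
    refine Eq.trans ?_ (tsum_subtype {i | i ∉ s} fun i => φ (μ i)).symm
    refine tsum_congr fun i => ?_
    by_cases hi : i ∈ s <;> simp [hi, hφ.map_zero]
  have hn := hT.mul_norm_le_one (c := 2 ^ m) (H1 _ hmod)
  push_cast at hn
  rw [div_lt_iff₀ hε] at hm
  by_contra! hle
  have : (2 : ℝ) ^ m * ε ≤ 2 ^ m * ‖w‖ := by gcongr
  linarith

/-- Hölder's inequality. -/
theorem norm_apply_le_two (hφ : IsOrlicz φ) (h2 : DeltaTwoZero φ) {R : H → H → V}
    (hR : ∀ a b, T (R a b) = InnerProductSpace.rankOne ℂ a b) {g : StrongDual ℂ V}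
    (hg : modular (complementary φ) (fun u v => ‖g (R u v)‖₊) ≤ 1) {y : V}
    (hy : modular φ (absForm (T y)) ≤ 1) : ‖g y‖ ≤ 2 := by
  refine le_of_forall_pos_le_add fun ε hε => ?_
  obtain ⟨ι, _, μ, e, f, he, hf, hs, hn⟩ := hT.exists_rankOne_approx hφ h2 hR hy
    (ε := ε / (‖g‖ + 1)) (by positivity)
  set w := ∑ i, (μ i : ℂ) • R (f i) (e i)
  have h1 : ‖g w‖₊ ≤ 2 := by
    have h3 : ‖g w‖₊ ≤ ∑ i, μ i * ‖g (R (f i) (e i))‖₊ := by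
      simp only [w, map_sum, map_smul, smul_eq_mul]
      refine (nnnorm_sum_le _ _).trans_eq (Finset.sum_congr rfl fun i _ => ?_)
      simp
    have h4 : ((∑ i, μ i * ‖g (R (f i) (e i))‖₊ : ℝ≥0) : ℝ≥0∞) ≤ 1 + 1 := by
      push_cast
      calc ∑ i, (μ i : ℝ≥0∞) * (‖g (R (f i) (e i))‖₊ : ℝ≥0∞)
          ≤ ∑ i, (φ (μ i) + complementary φ ‖g (R (f i) (e i))‖₊) :=
            Finset.sum_le_sum fun i _ => by
              rw [← ENNReal.coe_mul]
              exact mul_le_add_complementary φ _ _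
        _ ≤ 1 + 1 := by
            rw [Finset.sum_add_distrib]
            exact add_le_add hs ((le_modular _ (fun u v => ‖g (R u v)‖₊) hf he).trans hg)
    have h5 : ((∑ i, μ i * ‖g (R (f i) (e i))‖₊ : ℝ≥0) : ℝ≥0∞) ≤ ((2 : ℝ≥0) : ℝ≥0∞) :=
      h4.trans_eq (by norm_num)
    exact h3.trans (ENNReal.coe_le_coe.1 h5)
  have h1' : ‖g w‖ ≤ 2 := by exact_mod_cast h1
  have h6 : ‖g (y - w)‖ ≤ ε := by
    refine (g.le_opNorm _).trans ((mul_le_mul_of_nonneg_left hn (norm_nonneg _)).trans ?_)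
    rw [mul_div_assoc', div_le_iff₀ (by positivity)]
    nlinarith [norm_nonneg g]
  calc ‖g y‖ = ‖g w + g (y - w)‖ := by rw [← map_add, add_sub_cancel]
    _ ≤ 2 + ε := (norm_add_le _ _).trans (add_le_add h1' h6)

end IsLuxemburgModel

end Reflexive

/-! ### Density of matrix coefficients in the dual, and reflexivity. -/

section Density

variable {H : Type*} [NormedAddCommGroup H] [InnerProductSpace ℂ H]
  {V : Type*} [NormedAddCommGroup V] [NormedSpace ℂ V] {T : V →ₗ[ℂ] (H →L[ℂ] H)}
  {φ : ℝ≥0 → ℝ≥0∞}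

/-- The span of the matrix coefficients. -/
noncomputable def coeffSpan (T' : V →L[ℂ] (H →L[ℂ] H)) : Submodule ℂ (StrongDual ℂ V) :=
  Submodule.span ℂ (Set.range fun p : H × H => coeff T' p.1 p.2)

theorem coeff_mem_coeffSpan (T' : V →L[ℂ] (H →L[ℂ] H)) (u v : H) : coeff T' u v ∈ coeffSpan T' :=
  Submodule.subset_span ⟨(u, v), rfl⟩

variable [CompleteSpace H]

namespace IsLuxemburgModel

variable (hT : IsLuxemburgModel φ T)
include hT

theorem exists_inner_left {R : H → H → V}
    (hR : ∀ a b, T (R a b) = InnerProductSpace.rankOne ℂ a b) {D : ℝ}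
    (hD : ∀ a b, ‖R a b‖ ≤ D * (‖a‖ * ‖b‖)) (g : StrongDual ℂ V) (p : H) :
    ∃ l : H, ∀ h, g (R h p) = inner ℂ l h := by
  let L : H →ₗ[ℂ] ℂ :=
    { toFun := fun h => g (R h p)
      map_add' := fun a b => by
        rw [← map_add]
        congr 1
        exact hT.injective (by simp [hR])
      map_smul' := fun c a => by
        rw [RingHom.id_apply, ← map_smul]
        congr 1
        exact hT.injective (by simp [hR]) }
  let L' : StrongDual ℂ H := L.mkContinuous (‖g‖ * (D * ‖p‖)) fun h => by
    calc ‖g (R h p)‖ ≤ ‖g‖ * ‖R h p‖ := g.le_opNorm _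
      _ ≤ ‖g‖ * (D * (‖h‖ * ‖p‖)) := by gcongr; exact hD h p
      _ = ‖g‖ * (D * ‖p‖) * ‖h‖ := by ring
  refine ⟨(InnerProductSpace.toDual ℂ H).symm L', fun h => ?_⟩
  rw [InnerProductSpace.toDual_symm_apply]
  rfl

/-- The rank-one operator is conjugate-linear in its second vector, so Riesz representation is
applied to the conjugated functional. -/
theorem exists_inner_right {R : H → H → V}
    (hR : ∀ a b, T (R a b) = InnerProductSpace.rankOne ℂ a b) {D : ℝ}
    (hD : ∀ a b, ‖R a b‖ ≤ D * (‖a‖ * ‖b‖)) (g : StrongDual ℂ V) (q : H) :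
    ∃ l : H, ∀ h, g (R q h) = inner ℂ h l := by
  let L : H →ₗ[ℂ] ℂ :=
    { toFun := fun h => starRingEnd ℂ (g (R q h))
      map_add' := fun a b => by
        rw [← map_add, ← map_add]
        congr 2
        exact hT.injective (by simp [hR])
      map_smul' := fun c a => by
        rw [RingHom.id_apply, smul_eq_mul, ← Complex.conj_conj c, ← map_mul, ← smul_eq_mul,
          ← map_smul, Complex.conj_conj]
        congr 2
        exact hT.injective (by simp [hR]) }
  let L' : StrongDual ℂ H := L.mkContinuous (‖g‖ * (D * ‖q‖)) fun h => by
    calc ‖starRingEnd ℂ (g (R q h))‖ = ‖g (R q h)‖ := RCLike.norm_conj _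
      _ ≤ ‖g‖ * ‖R q h‖ := g.le_opNorm _
      _ ≤ ‖g‖ * (D * (‖q‖ * ‖h‖)) := by gcongr; exact hD q h
      _ = ‖g‖ * (D * ‖q‖) * ‖h‖ := by ring
  refine ⟨(InnerProductSpace.toDual ℂ H).symm L', fun h => ?_⟩
  rw [← inner_conj_symm, InnerProductSpace.toDual_symm_apply]
  exact (Complex.conj_conj _).symm

/-- Expanding the projection in an orthonormal basis of U writes M y as a finite sum of rank-one
operators with vectors (T y) bᵢ and bᵢ. By Riesz, g turns each summand into a matrix coefficient. -/
theorem comp_mem_coeffSpan_of_right {T' : V →L[ℂ] (H →L[ℂ] H)} (hT' : ∀ y, T' y = T y)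
    {R : H → H → V} (hR : ∀ a b, T (R a b) = InnerProductSpace.rankOne ℂ a b) {D : ℝ}
    (hD : ∀ a b, ‖R a b‖ ≤ D * (‖a‖ * ‖b‖)) (g : StrongDual ℂ V) {U : Submodule ℂ H}
    [FiniteDimensional ℂ U] {M : V →L[ℂ] V} (hM : ∀ y, T (M y) = T y ∘L U.starProjection) :
    g ∘L M ∈ coeffSpan T' := by
  set b := stdOrthonormalBasis ℂ U
  choose l hl using hT.exists_inner_left hR hD g
  have hMy : ∀ y, M y = ∑ i, R (T y (b i)) (b i) := fun y => hT.injective (by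
    rw [hM, b.starProjection_eq_sum_rankOne, map_sum]
    ext v
    simp [hR])
  have e : g ∘L M = ∑ i, coeff T' (l (b i)) (b i) := by
    ext y
    simp only [ContinuousLinearMap.comp_apply, sum_apply, coeff_apply, hT']
    rw [hMy, map_sum]
    exact Finset.sum_congr rfl fun i _ => hl _ _
  rw [e]
  exact Submodule.sum_mem _ fun i _ => coeff_mem_coeffSpan T' _ _

theorem comp_mem_coeffSpan_of_left {T' : V →L[ℂ] (H →L[ℂ] H)} (hT' : ∀ y, T' y = T y)
    {R : H → H → V} (hR : ∀ a b, T (R a b) = InnerProductSpace.rankOne ℂ a b) {D : ℝ}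
    (hD : ∀ a b, ‖R a b‖ ≤ D * (‖a‖ * ‖b‖)) (g : StrongDual ℂ V) {U : Submodule ℂ H}
    [FiniteDimensional ℂ U] {M : V →L[ℂ] V} (hM : ∀ y, T (M y) = U.starProjection ∘L T y) :
    g ∘L M ∈ coeffSpan T' := by
  set b := stdOrthonormalBasis ℂ U
  choose l hl using hT.exists_inner_right hR hD g
  have hMy : ∀ y, M y = ∑ i, R (b i) (ContinuousLinearMap.adjoint (T y) (b i)) := fun y =>
    hT.injective (by
      rw [hM, b.starProjection_eq_sum_rankOne, map_sum]
      ext v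
      simp [hR, ContinuousLinearMap.adjoint_inner_left])
  have e : g ∘L M = ∑ i, coeff T' (b i) (l (b i)) := by
    ext y
    simp only [ContinuousLinearMap.comp_apply, sum_apply, coeff_apply, hT']
    rw [hMy, map_sum]
    refine Finset.sum_congr rfl fun i _ => ?_
    rw [hl, ContinuousLinearMap.adjoint_inner_left]
  rw [e]
  exact Submodule.sum_mem _ fun i _ => coeff_mem_coeffSpan T' _ _

/-- The matrix coefficients span a dense subspace of the dual. -/
theorem mem_closure_coeffSpan (hφ : IsOrlicz φ) (h2 : DeltaTwoZero φ)
    (hψpos : ∀ u, 0 < u → 0 < complementary φ u) (hψ : DeltaTwoZero (complementary φ))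
    {T' : V →L[ℂ] (H →L[ℂ] H)} (hT' : ∀ y, T' y = T y) {f : StrongDual ℂ V} (hf : ‖f‖ ≤ 1) :
    f ∈ closure (coeffSpan T' : Set (StrongDual ℂ V)) := by
  obtain ⟨D, hRD⟩ := hT.exists_rankOne hφ
  choose R hR hD using hRD
  have hmod := hT.modular_complementary_le_one hφ hR hf
  rw [Metric.mem_closure_iff]
  intro ε hε
  obtain ⟨m, hm⟩ := pow_unbounded_of_one_lt (2 / ε) one_lt_two
  obtain ⟨δ, hδ, H1⟩ := hψ.exists_modular_scale_le_one (H := H) (complementary_mono φ) hψpos m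
  obtain ⟨U, W, hU, hW, hUW⟩ := exists_modular_cutoff_le (hmod.trans_lt ENNReal.one_lt_top).ne hδ
  have hid : ‖ContinuousLinearMap.id ℂ H‖ ≤ 1 := ContinuousLinearMap.norm_id_le
  obtain ⟨M₁, hM₁, -⟩ := hT.exists_compression hid W.starProjection_norm_le
  obtain ⟨M₂, hM₂, -⟩ := hT.exists_compression hid Wᗮ.starProjection_norm_le
  obtain ⟨M₃, hM₃, -⟩ := hT.exists_compression U.starProjection_norm_le hid
  obtain ⟨M₄, hM₄, -⟩ := hT.exists_compression Uᗮ.starProjection_norm_le Wᗮ.starProjection_norm_le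
  -- With P, Q the projections onto U, W: y = yQ + Py(1 - Q) + (1 - P)y(1 - Q). The first two terms
  -- are compressed to finite dimension on one side; the last is small.
  have hdec : ∀ y, y = M₁ y + M₂ (M₃ y) + M₄ y := fun y => hT.injective (by
    rw [map_add, map_add, hM₁, hM₂, hM₃, hM₄]
    ext v
    simp only [Submodule.starProjection_orthogonal, sub_apply, add_apply,
      ContinuousLinearMap.comp_apply, ContinuousLinearMap.id_apply, map_sub]
    abel)
  set g := f ∘L M₁ + (f ∘L M₂) ∘L M₃
  have hfg : f - g = f ∘L M₄ := by
    ext y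
    have h1 : f y = f (M₁ y) + f (M₂ (M₃ y)) + f (M₄ y) := by
      rw [← map_add, ← map_add, ← hdec]
    simp only [g, sub_apply, add_apply, ContinuousLinearMap.comp_apply, h1]
    ring
  have hRM : ∀ u v, M₄ (R u v) = R (Uᗮ.starProjection u) (Wᗮ.starProjection v) := fun u v =>
    hT.injective (by
      rw [hM₄, hR, hR]
      ext h
      simp only [ContinuousLinearMap.comp_apply, InnerProductSpace.rankOne_apply, map_smul,
        Submodule.inner_starProjection_left_eq_right])
  have hscaled : modular (complementary φ)
      (fun u v => ‖((2 ^ m : ℂ) • (f ∘L M₄)) (R u v)‖₊) ≤ 1 := by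
    refine le_of_eq_of_le ?_ (H1 _ hUW)
    congr 1
    ext u v : 2
    rw [smul_apply, ContinuousLinearMap.comp_apply, hRM, nnnorm_smul, nnnorm_pow,
      show ‖(2 : ℂ)‖₊ = 2 by simp]
  have hbound : ∀ y, ‖((2 ^ m : ℂ) • (f ∘L M₄)) y‖ ≤ 2 * ‖y‖ :=
    hT.norm_le_mul (((2 ^ m : ℂ) • (f ∘L M₄) : StrongDual ℂ V) : V →ₗ[ℂ] ℂ) zero_le_two
      fun y hy => hT.norm_apply_le_two hφ h2 hR hscaled hy
  have hn : ‖(2 ^ m : ℂ) • (f ∘L M₄)‖ ≤ 2 := ContinuousLinearMap.opNorm_le_bound _ zero_le_two hbound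
  refine ⟨g, Submodule.add_mem _ ?_ ?_, ?_⟩
  · exact hT.comp_mem_coeffSpan_of_right hT' hR hD f fun y => by rw [hM₁]; rfl
  · exact hT.comp_mem_coeffSpan_of_left hT' hR hD _ fun y => by rw [hM₃]; rfl
  · rw [dist_eq_norm, hfg]
    rw [norm_smul] at hn
    simp only [norm_pow, Complex.norm_ofNat] at hn
    rw [div_lt_iff₀ hε] at hm
    by_contra! hle
    have : (2 : ℝ) ^ m * ε ≤ 2 ^ m * ‖f ∘L M₄‖ := by gcongr
    linarith

/-- Evaluation at the point found for z agrees with z on matrix coefficients, hence on their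
closure. Scaling removes both unit-ball restrictions. -/
theorem isReflexiveSpace (hφ : IsOrlicz φ) (h2 : DeltaTwoZero φ)
    (hψpos : ∀ u, 0 < u → 0 < complementary φ u) (hψ : DeltaTwoZero (complementary φ)) :
    IsReflexiveSpace V := by
  obtain ⟨T', hT'⟩ := hT.exists_continuous hφ
  have unit : ∀ z : StrongDual ℂ (StrongDual ℂ V), ‖z‖ ≤ 1 →
      ∃ y, NormedSpace.inclusionInDoubleDual ℂ V y = z := fun z hz => by
    obtain ⟨y, hy⟩ := hT.exists_point_of_bidual hφ h2 hT' hz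
    refine ⟨y, ?_⟩
    have hspan : Set.EqOn (NormedSpace.inclusionInDoubleDual ℂ V y) z
        (closure (coeffSpan T' : Set (StrongDual ℂ V))) := by
      refine Set.EqOn.closure (fun f hf => ?_) (ContinuousLinearMap.continuous _) z.continuous
      refine LinearMap.eqOn_span (f := (NormedSpace.inclusionInDoubleDual ℂ V y : _ →ₗ[ℂ] ℂ))
        (g := (z : _ →ₗ[ℂ] ℂ)) ?_ hf
      rintro _ ⟨p, rfl⟩
      exact (hy p.1 p.2).symm
    ext f
    have hr : 0 < ‖f‖ + 1 := by positivity
    have hne : (((‖f‖ + 1)⁻¹ : ℝ) : ℂ) ≠ 0 := by exact_mod_cast (inv_pos.2 hr).ne'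
    have h1 := hspan (hT.mem_closure_coeffSpan hφ h2 hψpos hψ hT'
      (f := (((‖f‖ + 1)⁻¹ : ℝ) : ℂ) • f) (by
        rw [norm_smul, Complex.norm_real, Real.norm_of_nonneg (by positivity),
          inv_mul_le_iff₀ hr]
        linarith))
    rw [map_smul, map_smul] at h1
    exact smul_right_injective _ hne h1
  intro z
  have hr : 0 < ‖z‖ + 1 := by positivity
  have hne : (((‖z‖ + 1 : ℝ)) : ℂ) ≠ 0 := by exact_mod_cast hr.ne'
  obtain ⟨y, hy⟩ := unit (((‖z‖ + 1 : ℝ) : ℂ)⁻¹ • z) (by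
    refine (ContinuousLinearMap.opNorm_smul_le _ _).trans ?_
    rw [norm_inv, Complex.norm_real, Real.norm_of_nonneg (by positivity),
      inv_mul_le_iff₀ hr]
    linarith)
  exact ⟨((‖z‖ + 1 : ℝ) : ℂ) • y, by rw [map_smul, hy, smul_inv_smul₀ hne]⟩

end IsLuxemburgModel

end Density

/-! ### The Luxemburg norm on the Orlicz–Schatten class. -/

section Luxemburg

variable {H : Type*} [NormedAddCommGroup H] [InnerProductSpace ℂ H] [CompleteSpace H]
  {φ : ℝ≥0 → ℝ≥0∞}

theorem IsOrlicz.tsum_mul_singularValue (hφ : IsOrlicz φ) {x : H →L[ℂ] H}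
    (hx : IsCompactOperator x) {c : ℝ≥0} (hc : 0 < c) :
    ∑' n, φ (c * singularValue x n) = modular φ fun u v => c * absForm x u v :=
  (hφ.comp_mul hc).tsum_singularValue hx

theorem IsOrlicz.mem_orliczClass_iff (hφ : IsOrlicz φ) {x : H →L[ℂ] H} :
    x ∈ orliczClass φ ↔ IsCompactOperator x ∧
      ∃ c : ℝ≥0, 0 < c ∧ modular φ (fun u v => c * absForm x u v) < ∞ := by
  refine and_congr_right fun hx => exists_congr fun c => and_congr_right fun hc => ?_
  rw [hφ.tsum_mul_singularValue hx hc]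

/-- `orliczClass φ` as a linear subspace. -/
noncomputable def orliczSubmodule (hφ : IsOrlicz φ) : Submodule ℂ (H →L[ℂ] H) where
  carrier := orliczClass φ
  zero_mem' := hφ.mem_orliczClass_iff.2 ⟨isCompactOperator_zero, 1, one_pos, by
    refine (modular_le (C := 0) fun n u v _ _ => ?_).trans_lt ENNReal.zero_lt_top
    simp [absForm, hφ.map_zero]⟩
  add_mem' := by
    intro x y hx hy
    rw [hφ.mem_orliczClass_iff] at hx hy ⊢
    obtain ⟨hx, c, hc, hxc⟩ := hx
    obtain ⟨hy, d, hd, hyd⟩ := hy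
    refine ⟨hx.add hy, min c d / 2, by positivity, ?_⟩
    refine (hφ.modular_add_le (a := 1 / 2) (b := 1 / 2) (by norm_num) fun u v => ?_).trans_lt
      (ENNReal.add_lt_top.2 ⟨ENNReal.mul_lt_top ENNReal.coe_lt_top hxc,
        ENNReal.mul_lt_top ENNReal.coe_lt_top hyd⟩)
    calc min c d / 2 * absForm (x + y) u v ≤ min c d / 2 * (absForm x u v + absForm y u v) := by
          gcongr
          exact absForm_add_le x y u v
      _ = 1 / 2 * (min c d * absForm x u v) + 1 / 2 * (min c d * absForm y u v) := by ring
      _ ≤ 1 / 2 * (c * absForm x u v) + 1 / 2 * (d * absForm y u v) := by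
          gcongr
          · exact min_le_left _ _
          · exact min_le_right _ _
  smul_mem' := by
    intro a x hx
    rw [hφ.mem_orliczClass_iff] at hx ⊢
    obtain ⟨hx, c, hc, hxc⟩ := hx
    refine ⟨hx.smul a, c / (‖a‖₊ + 1), by positivity, ?_⟩
    refine (modular_mono hφ.mono fun u v => ?_).trans_lt hxc
    rw [absForm_smul, ← mul_assoc]
    gcongr
    rw [div_mul_eq_mul_div]
    refine div_le_of_le_mul₀ zero_le zero_le ?_
    gcongr
    exact le_self_add

theorem IsOrlicz.luxemburgNorm_eq (hφ : IsOrlicz φ) {x : H →L[ℂ] H} (hx : IsCompactOperator x) :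
    luxemburgNorm φ x =
      ((sInf {r : ℝ≥0 | 0 < r ∧ modular φ (fun u v => r⁻¹ * absForm x u v) ≤ 1} : ℝ≥0) : ℝ) := by
  unfold luxemburgNorm
  congr 2
  ext r
  refine and_congr_right fun hr => ?_
  rw [← hφ.tsum_mul_singularValue hx (inv_pos.2 hr)]
  simp only [div_eq_inv_mul]

theorem IsOrlicz.luxemburgNorm_le (hφ : IsOrlicz φ) {x : H →L[ℂ] H} (hx : IsCompactOperator x)
    {r : ℝ≥0} (hr : 0 < r) (h : modular φ (fun u v => r⁻¹ * absForm x u v) ≤ 1) :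
    luxemburgNorm φ x ≤ r := by
  rw [hφ.luxemburgNorm_eq hx, NNReal.coe_le_coe]
  exact csInf_le (OrderBot.bddBelow _) ⟨hr, h⟩

theorem IsOrlicz.modular_le_one_of_luxemburgNorm_lt (hφ : IsOrlicz φ) {x : H →L[ℂ] H}
    (hx : x ∈ orliczClass φ) {r : ℝ≥0} (h : luxemburgNorm φ x < r) :
    modular φ (fun u v => r⁻¹ * absForm x u v) ≤ 1 := by
  obtain ⟨hc, c, hc0, hfin⟩ := hφ.mem_orliczClass_iff.1 hx
  rw [hφ.luxemburgNorm_eq hc, NNReal.coe_lt_coe] at h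
  obtain ⟨K, hK⟩ : ∃ K : ℝ≥0, (K : ℝ≥0∞) = modular φ (fun u v => c * absForm x u v) :=
    ⟨_, ENNReal.coe_toNNReal hfin.ne⟩
  have hne : {r : ℝ≥0 | 0 < r ∧ modular φ (fun u v => r⁻¹ * absForm x u v) ≤ 1}.Nonempty := by
    -- Convexity through 0 divides the finite modular K by K + 1, so the set of admissible radii is
    -- nonempty.
    refine ⟨(c / (K + 1))⁻¹, by positivity, ?_⟩
    have h1 := hφ.modular_mul_le (fun u v => c * absForm x u v)
      (inv_le_one_of_one_le₀ (le_add_self : 1 ≤ K + 1))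
    simp only [inv_inv, div_eq_inv_mul, mul_assoc] at h1 ⊢
    refine h1.trans ?_
    rw [← hK, ← ENNReal.coe_mul, ← ENNReal.coe_one, ENNReal.coe_le_coe,
      inv_mul_le_iff₀ (by positivity), mul_one]
    exact le_self_add
  obtain ⟨r', ⟨hr'0, hr'⟩, hlt⟩ := exists_lt_of_csInf_lt hne h
  refine (modular_mono hφ.mono fun u v => ?_).trans hr'
  gcongr

theorem IsOrlicz.luxemburgNorm_smul_le (hφ : IsOrlicz φ) {x : H →L[ℂ] H} (hx : x ∈ orliczClass φ)
    (a : ℂ) : luxemburgNorm φ (a • x) ≤ ‖a‖ * luxemburgNorm φ x := by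
  refine le_mul_of_forall_lt (norm_nonneg a) fun r hr => ?_
  have hr0 : 0 < r := NNReal.zero_le_coe.trans_lt hr
  lift r to ℝ≥0 using hr0.le
  have hr0' : 0 < r := by exact_mod_cast hr0
  have hm := hφ.modular_le_one_of_luxemburgNorm_lt hx hr
  have hc : IsCompactOperator (a • x : H →L[ℂ] H) := hx.1.smul a
  refine le_of_forall_pos_le_add fun ε hε => ?_
  lift ε to ℝ≥0 using hε.le
  have hε' : 0 < ε := by exact_mod_cast hε
  -- The added ε keeps the radius positive when a = 0.
  have := hφ.luxemburgNorm_le hc (r := ‖a‖₊ * r + ε) (by positivity)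
    ((modular_mono hφ.mono fun u v => ?_).trans hm)
  · simpa using this
  · rw [absForm_smul, ← mul_assoc]
    gcongr
    rw [inv_mul_le_iff₀ (by positivity), ← div_eq_mul_inv, le_div_iff₀ hr0']
    exact le_self_add

theorem IsOrlicz.luxemburgNorm_add_le (hφ : IsOrlicz φ) {x y : H →L[ℂ] H}
    (hx : x ∈ orliczClass φ) (hy : y ∈ orliczClass φ) :
    luxemburgNorm φ (x + y) ≤ luxemburgNorm φ x + luxemburgNorm φ y := by
  have hc : IsCompactOperator (x + y : H →L[ℂ] H) := hx.1.add hy.1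
  refine le_of_forall_pos_le_add fun ε hε => ?_
  obtain ⟨r, hr⟩ : ∃ r : ℝ≥0, (r : ℝ) = luxemburgNorm φ x + ε / 2 :=
    ⟨⟨_, add_nonneg NNReal.zero_le_coe (half_pos hε).le⟩, rfl⟩
  obtain ⟨s, hs⟩ : ∃ s : ℝ≥0, (s : ℝ) = luxemburgNorm φ y + ε / 2 :=
    ⟨⟨_, add_nonneg NNReal.zero_le_coe (half_pos hε).le⟩, rfl⟩
  have hxr : luxemburgNorm φ x < r := by linarith
  have hys : luxemburgNorm φ y < s := by linarith
  have hr0 : 0 < r := by exact_mod_cast NNReal.zero_le_coe.trans_lt hxr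
  have hs0 : 0 < s := by exact_mod_cast NNReal.zero_le_coe.trans_lt hys
  have hrs : r / (r + s) + s / (r + s) = 1 := by
    rw [← add_div, div_self (by positivity)]
  have hm : modular φ (fun u v => (r + s)⁻¹ * absForm (x + y) u v) ≤ 1 := by
    refine (hφ.modular_add_le hrs.le fun u v => ?_).trans
      (c := ((r / (r + s) : ℝ≥0) : ℝ≥0∞) * 1 + ((s / (r + s) : ℝ≥0) : ℝ≥0∞) * 1)
      (add_le_add (mul_le_mul_right (hφ.modular_le_one_of_luxemburgNorm_lt hx hxr) _)
        (mul_le_mul_right (hφ.modular_le_one_of_luxemburgNorm_lt hy hys) _)) |>.trans ?_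
    · calc (r + s)⁻¹ * absForm (x + y) u v ≤ (r + s)⁻¹ * (absForm x u v + absForm y u v) := by
            gcongr
            exact absForm_add_le x y u v
        _ = r / (r + s) * (r⁻¹ * absForm x u v) + s / (r + s) * (s⁻¹ * absForm y u v) := by
            field_simp
    · rw [mul_one, mul_one, ← ENNReal.coe_add, hrs, ENNReal.coe_one]
  have := hφ.luxemburgNorm_le hc (by positivity) hm
  push_cast at this
  linarith

theorem IsOrlicz.eq_zero_of_luxemburgNorm_eq_zero (hφ : IsOrlicz φ) {x : H →L[ℂ] H}
    (hx : x ∈ orliczClass φ) (h : luxemburgNorm φ x = 0) : x = 0 := by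
  obtain ⟨C, hC⟩ := hφ.exists_one_lt
  have key : ∀ r : ℝ, luxemburgNorm φ x < r → ‖x‖ ≤ C * r := fun r hr => by
    have hr0 : 0 < r := NNReal.zero_le_coe.trans_lt hr
    lift r to ℝ≥0 using hr0.le
    have hm := hφ.modular_le_one_of_luxemburgNorm_lt hx hr
    have h1 := norm_le_of_modular_le_one hφ.mono hC (x := (((r⁻¹ : ℝ≥0) : ℝ) : ℂ) • x) (by
      rw [modular_absForm_smul]
      simpa using hm)
    rw [norm_smul, Complex.norm_real, Real.norm_of_nonneg (by positivity), NNReal.coe_inv,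
      inv_mul_le_iff₀ hr0] at h1
    linarith
  have := le_mul_of_forall_lt C.2 key
  rw [h, mul_zero] at this
  exact norm_le_zero_iff.1 this

theorem IsOrlicz.luxemburgNorm_smul (hφ : IsOrlicz φ) {x : H →L[ℂ] H} (hx : x ∈ orliczClass φ)
    (a : ℂ) : luxemburgNorm φ (a • x) = ‖a‖ * luxemburgNorm φ x := by
  refine le_antisymm (hφ.luxemburgNorm_smul_le hx a) ?_
  rcases eq_or_ne a 0 with rfl | ha
  · rw [norm_zero, zero_mul]
    exact NNReal.zero_le_coe
  have h := hφ.luxemburgNorm_smul_le ((orliczSubmodule hφ).smul_mem a hx) a⁻¹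
  rw [inv_smul_smul₀ ha, norm_inv] at h
  rwa [le_inv_mul_iff₀ (norm_pos_iff.2 ha)] at h

/-- Passes from a bare norm satisfying the axioms to the normed-space instances presupposed by
`IsLuxemburgModel`. -/
theorem isReflexiveSpace_ofCore {V : Type*} [AddCommGroup V] [Module ℂ V] [Norm V]
    (core : NormedSpace.Core ℂ V) (T : V →ₗ[ℂ] (H →L[ℂ] H)) (hinj : Function.Injective T)
    (hcomp : ∀ y, IsCompactOperator (T y))
    (hex : ∀ (A : H →L[ℂ] H) (c : ℝ≥0), IsCompactOperator A → 0 < c →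
      modular φ (fun u v => c * absForm A u v) ≠ ∞ → ∃ y, T y = A)
    (hmod : ∀ y, ‖y‖ < 1 → modular φ (absForm (T y)) ≤ 1)
    (hnorm : ∀ y, modular φ (absForm (T y)) ≤ 1 → ‖y‖ ≤ 1) (hφ : IsOrlicz φ)
    (hψpos : ∀ u, 0 < u → 0 < complementary φ u) (h2 : DeltaTwoZero φ)
    (hψ : DeltaTwoZero (complementary φ)) :
    letI : NormedAddCommGroup V := NormedAddCommGroup.ofCore core
    letI : NormedSpace ℂ V := NormedSpace.ofCore core
    IsReflexiveSpace V := by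
  let _ : NormedAddCommGroup V := NormedAddCommGroup.ofCore core
  let _ : NormedSpace ℂ V := NormedSpace.ofCore core
  have hT : IsLuxemburgModel φ T := ⟨hinj, hcomp, hex, hmod, hnorm⟩
  exact hT.isReflexiveSpace hφ h2 hψpos hψ

/-- The Orlicz–Schatten class is reflexive under the Luxemburg norm. -/
theorem IsOrlicz.isReflexiveUnder (hφ : IsOrlicz φ)
    (hψpos : ∀ u, 0 < u → 0 < complementary φ u) (h2 : DeltaTwoZero φ)
    (hψ : DeltaTwoZero (complementary φ)) :
    IsReflexiveUnder (orliczClass φ : Set (H →L[ℂ] H)) (luxemburgNorm φ) := by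
  refine ⟨orliczSubmodule hφ, rfl, ?_⟩
  let _ : Norm (orliczSubmodule (H := H) hφ) := ⟨fun x => luxemburgNorm φ (x : H →L[ℂ] H)⟩
  have core : NormedSpace.Core ℂ (orliczSubmodule (H := H) hφ) :=
    { norm_nonneg := fun x => NNReal.zero_le_coe
      norm_smul := fun c x => hφ.luxemburgNorm_smul x.2 c
      norm_triangle := fun x y => hφ.luxemburgNorm_add_le x.2 y.2
      norm_eq_zero_iff := fun x => by
        refine ⟨fun h => Subtype.ext (hφ.eq_zero_of_luxemburgNorm_eq_zero x.2 h), ?_⟩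
        rintro rfl
        have := hφ.luxemburgNorm_smul (orliczSubmodule (H := H) hφ).zero_mem 0
        rw [norm_zero, zero_mul, smul_zero] at this
        exact this }
  refine ⟨core, ?_⟩
  exact isReflexiveSpace_ofCore core (orliczSubmodule hφ).subtype Subtype.val_injective
    (fun y => y.2.1) (fun A c hA hc h => ⟨⟨A, hφ.mem_orliczClass_iff.2 ⟨hA, c, hc, h.lt_top⟩⟩, rfl⟩)
    (fun y hy => by
      have := hφ.modular_le_one_of_luxemburgNorm_lt y.2 (r := 1) (by exact_mod_cast hy)
      simpa using this)
    (fun y hy => by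
      have := hφ.luxemburgNorm_le y.2.1 one_pos (by simpa using hy)
      exact_mod_cast this) hφ hψpos h2 hψ

end Luxemburg

/-! ### The power functions and the Schatten classes. -/

section Power

variable {p : ℝ}

theorem isOrlicz_rpow (hp : 1 < p) : IsOrlicz fun u : ℝ≥0 => (u : ℝ≥0∞) ^ p where
  convex := ⟨convex_univ, fun x _ y _ a b _ _ hab => by
    have := ENNReal.rpow_arith_mean_le_arith_mean2_rpow a b x y (by exact_mod_cast hab) hp.le
    simpa [ENNReal.smul_def] using this⟩
  mono := fun x y h => ENNReal.rpow_le_rpow (by exact_mod_cast h) (by linarith)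
  cont := ENNReal.continuous_rpow_const.comp ENNReal.continuous_coe
  map_zero := by simpa using ENNReal.zero_rpow_of_pos (by linarith)
  pos := fun u hu => ENNReal.rpow_pos (by exact_mod_cast hu) ENNReal.coe_ne_top
  tendsto_top := by
    have h1 := (ENNReal.tendsto_coe_nhds_top (f := fun u : ℝ≥0 => u)).2 Filter.tendsto_id
    have h2 := (ENNReal.continuous_rpow_const (y := p)).tendsto ∞
    rw [ENNReal.top_rpow_of_pos (by linarith)] at h2
    exact h2.comp h1

theorem deltaTwoZero_rpow (hp : 1 < p) : DeltaTwoZero fun u : ℝ≥0 => (u : ℝ≥0∞) ^ p := by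
  refine ⟨1, one_pos, 2 ^ p, ?_, fun u _ => le_of_eq ?_⟩
  · simpa using NNReal.rpow_lt_rpow_of_exponent_lt (x := 2) (by norm_num) hp
  · simp only
    rw [ENNReal.coe_mul, ENNReal.mul_rpow_of_nonneg _ _ (by linarith),
      ENNReal.coe_rpow_of_nonneg _ (by linarith)]

theorem exists_rpow_eq_mul (hp : 1 < p) (c : ℝ≥0) (hc : 0 < c) :
    ∃ a : ℝ≥0, 0 < a ∧ a ^ p = c * a ∧ (1 < c → 1 < a) := by
  have hp' : 0 < p - 1 := by linarith
  have ha : 0 < c ^ (1 / (p - 1)) := NNReal.rpow_pos hc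
  refine ⟨c ^ (1 / (p - 1)), ha, ?_, fun h => NNReal.one_lt_rpow h (by positivity)⟩
  have h : (c ^ (1 / (p - 1))) ^ (p - 1) = c := by
    rw [← NNReal.rpow_mul, one_div_mul_cancel hp'.ne', NNReal.rpow_one]
  have h1 := NNReal.rpow_add_one ha.ne' (p - 1)
  rwa [sub_add_cancel, h] at h1

theorem complementary_rpow_pos (hp : 1 < p) {u : ℝ≥0} (hu : 0 < u) :
    0 < complementary (fun u : ℝ≥0 => (u : ℝ≥0∞) ^ p) u := by
  -- At this a, the term u·a - aᵖ equals u·a/2, which is positive.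
  obtain ⟨a, ha, hap, -⟩ := exists_rpow_eq_mul hp (u / 2) (by positivity)
  refine lt_of_lt_of_le ?_ (le_iSup (fun v : ℝ≥0 => ((u * v : ℝ≥0) : ℝ≥0∞) - (v : ℝ≥0∞) ^ p) a)
  rw [tsub_pos_iff_lt, ← ENNReal.coe_rpow_of_nonneg _ (by linarith), hap, ENNReal.coe_lt_coe]
  exact mul_lt_mul_of_pos_right (NNReal.half_lt_self hu.ne') ha

theorem deltaTwoZero_complementary_rpow (hp : 1 < p) :
    DeltaTwoZero (complementary fun u : ℝ≥0 => (u : ℝ≥0∞) ^ p) := by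
  -- With aᵖ = 2a, the substitution v = a·w gives 2uv - vᵖ = 2a(uw - wᵖ). The constant 2a exceeds 2
  -- because a > 1.
  obtain ⟨a, ha, hap, ha1⟩ := exists_rpow_eq_mul hp 2 two_pos
  refine ⟨1, one_pos, 2 * a, ?_, fun u _ => iSup_le fun v => ?_⟩
  · simpa using ha1 (by norm_num)
  · have e : ((2 * u * v : ℝ≥0) : ℝ≥0∞) - (v : ℝ≥0∞) ^ p =
        ((2 * a : ℝ≥0) : ℝ≥0∞) * (((u * (v / a) : ℝ≥0) : ℝ≥0∞) - ((v / a : ℝ≥0) : ℝ≥0∞) ^ p) := by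
      rw [ENNReal.mul_sub fun _ _ => ENNReal.coe_ne_top, ← ENNReal.coe_mul, ← hap,
        ← ENNReal.coe_rpow_of_nonneg _ (by linarith), ← ENNReal.coe_rpow_of_nonneg _ (by linarith),
        ← ENNReal.coe_mul, ← NNReal.mul_rpow, mul_div_cancel₀ _ ha.ne']
      congr 2
      rw [hap]
      field_simp
    rw [e]
    gcongr
    exact le_iSup (fun v : ℝ≥0 => ((u * v : ℝ≥0) : ℝ≥0∞) - (v : ℝ≥0∞) ^ p) (v / a)

variable {H : Type*} [NormedAddCommGroup H] [InnerProductSpace ℂ H] [CompleteSpace H]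

theorem orliczClass_rpow (hp : 1 < p) :
    (orliczClass (fun u : ℝ≥0 => (u : ℝ≥0∞) ^ p) : Set (H →L[ℂ] H)) = schattenClass p := by
  ext x
  refine and_congr_right fun _ => ⟨?_, fun h => ⟨1, one_pos, by simpa using h⟩⟩
  rintro ⟨c, hc, h⟩
  simp only [ENNReal.coe_mul, ENNReal.mul_rpow_of_nonneg _ _ (by linarith : 0 ≤ p)] at h
  rw [ENNReal.tsum_mul_left] at h
  refine (ENNReal.lt_top_of_mul_ne_top_right h.ne ?_)
  exact (ENNReal.rpow_pos (by exact_mod_cast hc) ENNReal.coe_ne_top).ne'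

theorem luxemburgNorm_rpow (hp : 1 < p) :
    (luxemburgNorm (fun u : ℝ≥0 => (u : ℝ≥0∞) ^ p) : (H →L[ℂ] H) → ℝ) = schattenNorm p := by
  have hp0 : 0 < p := by linarith
  ext x
  unfold luxemburgNorm schattenNorm
  set A : ℝ≥0∞ := (∑' n, (singularValue x n : ℝ≥0∞) ^ p) ^ (1 / p) with hA
  have hset : {r : ℝ≥0 | 0 < r ∧ ∑' n, ((singularValue x n / r : ℝ≥0) : ℝ≥0∞) ^ p ≤ 1} =
      {r : ℝ≥0 | 0 < r ∧ A ≤ r} := by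
    ext r
    refine and_congr_right fun hr => ?_
    have hr' : (r : ℝ≥0∞) ≠ 0 := by exact_mod_cast hr.ne'
    have e : ∀ n, ((singularValue x n / r : ℝ≥0) : ℝ≥0∞) ^ p =
        (singularValue x n : ℝ≥0∞) ^ p * ((r : ℝ≥0∞) ^ p)⁻¹ := fun n => by
      rw [ENNReal.coe_div hr.ne', ENNReal.div_rpow_of_nonneg _ _ hp0.le, div_eq_mul_inv]
    simp only [e]
    rw [ENNReal.tsum_mul_right, ← div_eq_mul_inv, hA, one_div, ENNReal.rpow_inv_le_iff hp0, ENNReal.div_le_iff,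
      one_mul]
    · simp [hr']
    · simp [hp0.le]
  rw [hset]
  -- The two functions must agree on all operators. When A = ∞ no radius is admissible, and both
  -- sides take the default value 0.
  rcases eq_or_ne A ∞ with htop | hfin
  · simp [htop]
  · obtain ⟨a, ha⟩ : ∃ a : ℝ≥0, (a : ℝ≥0∞) = A := ⟨_, ENNReal.coe_toNNReal hfin⟩
    rw [← ha]
    simp only [ENNReal.coe_le_coe, ENNReal.coe_toReal, NNReal.coe_inj]
    refine le_antisymm (le_of_forall_pos_le_add fun ε hε => ?_)
      (le_csInf ⟨a + 1, by positivity, le_self_add⟩ fun r hr => hr.2)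
    exact csInf_le (OrderBot.bddBelow _) ⟨by positivity, le_self_add⟩

end Power

end OrliczSchatten

theorem corollary3p2 {H : Type*} [NormedAddCommGroup H] [InnerProductSpace ℂ H]
    [CompleteSpace H] [TopologicalSpace.SeparableSpace H] :
    (∀ φ : ℝ≥0 → ℝ≥0∞, OrliczSchatten.IsOrlicz φ →
      (∀ u : ℝ≥0, 0 < u → 0 < OrliczSchatten.complementary φ u) →
      OrliczSchatten.DeltaTwoZero φ →
      OrliczSchatten.DeltaTwoZero (OrliczSchatten.complementary φ) →
      OrliczSchatten.IsReflexiveUnder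
        (OrliczSchatten.orliczClass φ : Set (H →L[ℂ] H)) (OrliczSchatten.luxemburgNorm φ)) ∧
    (∀ p : ℝ, 1 < p →
      OrliczSchatten.IsReflexiveUnder
        (OrliczSchatten.schattenClass p : Set (H →L[ℂ] H)) (OrliczSchatten.schattenNorm p)) := by
  refine ⟨fun φ hφ hψpos h2 hψ => hφ.isReflexiveUnder hψpos h2 hψ, fun p hp => ?_⟩
  rw [← OrliczSchatten.orliczClass_rpow hp, ← OrliczSchatten.luxemburgNorm_rpow hp]
  exact (OrliczSchatten.isOrlicz_rpow hp).isReflexiveUnder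
    (fun _ => OrliczSchatten.complementary_rpow_pos hp) (OrliczSchatten.deltaTwoZero_rpow hp)
    (OrliczSchatten.deltaTwoZero_complementary_rpow hp)
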